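/- Let $A=\mathbb F_q[\theta]$, $K=\mathbb F_q(\theta)$, $K_\infty$ the completion of $K$ at the place $1/\theta$, $\mathbb C_\infty$ the completion of an algebraic closure of $K_\infty$, and let $\mathbb T_s$ be the Tate algebra in $t_1,\dots,t_s$ over $\mathbb C_\infty$, i.e. the completion of $\mathbb C_\infty[t_1,\dots,t_s]$ for the Gauss norm. Let $s\ge q$ with $s\equiv 1\pmod{q-1}$, and put $m=\frac{s-1}{q-1}$ and $\mu=\frac{q^m-1}{q-1}-m$. For $a\in A$ let $a(t)$ be the result of substituting $t$ for $\theta$ in $a$, and for $d\ge 1$ let $$F_d(1;s)=\sum_{i=0}^{d-1}\ \sum_{a\in A\text{ monic},\ \deg a=i}\frac{a(t_1)\cdots a(t_s)}{a}\in K[t_1,\dots,t_s].$$ Put $l_d=\prod_{k=1}^{d}(\theta-\theta^{q^k})$, $b_i(t)=\prod_{k=0}^{i-1}(t-\theta^{q^k})$ and $\Pi_{s,d}=b_{d-m}(t_1)\cdots b_{d-m}(t_s)/l_{d-1}$ for $d\ge m$. There is a unique polynomial $\mathbb H_s\in A[t_1,\dots,t_s][Y]$ such that $F_d(1;s)=\Pi_{s,d}\,\mathbb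 H_s|_{Y=\theta^{q^{d-m}}}$ for all $d\ge m$, and it has degree $\mu$ in $Y$; write $\mathbb H_s=\sum_{i=0}^{\mu}\mathbb D_iY^i$ with $\mathbb D_i\in A[t_1,\dots,t_s]$. Choose a root $(-\theta)^{1/(q-1)}\in\mathbb C_\infty$ and set $$\omega(t)=(-\theta)^{\frac1{q-1}}\prod_{i\ge0}\Bigl(1-\frac{t}{\theta^{q^i}}\Bigr)^{-1},\qquad \widetilde\pi=\theta(-\theta)^{\frac1{q-1}}\prod_{i\ge1}\Bigl(1-\frac{\theta}{\theta^{q^i}}\Bigr)^{-1},$$ $$\Gamma_d=\frac{\prod_{i\ge d-m}\prod_{j=1}^s\bigl(1-\frac{t_j}{\theta^{q^i}}\bigr)}{\prod_{i\ge d}\bigl(1-\frac{\theta}{\theta^{q^i}}\bigr)}\in\mathbb T_s\qquad(d\ge m).$$ Let $h=\sum_{k\ge0}h_kY^k\in A[t_1,\dots,t_s][[Y]]$ be the formal power series $$h=\frac{\prod_{j=1}^s\prod_{i\ge0}(1-t_jY^{q^i})}{\prod_{i\ge0}(1-\theta Y^{q^{m+i}})}$$ (the expansion of $\Gamma_d$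 in powers of $Y=\theta^{-q^{d-m}}$), and for $0\le r\le\mu$ put $\Gamma_{s,r}=\sum_{k=0}^{\mu-r}h_kY^{\mu-r-k}\in A[t_1,\dots,t_s][Y]$. Then $\Gamma_{s,r}$ is monic of degree $\mu-r$ in $Y$, and $\theta^{(\mu-r)q^{d-m}}\Gamma_d-\Gamma_{s,r}(\theta^{q^{d-m}})\to0$ in $\mathbb T_s$ as $d\to\infty$. Moreover, for all $0\le r\le\mu-1$, with the limit taken in $\mathbb T_s$, $$\mathbb D_r=-\lim_{d\to\infty}\left(\frac{\omega(t_1)\cdots\omega(t_s)}{\widetilde\pi}\,\Gamma_{s,r}(\theta^{q^{d-m}})\,F_d(1;s)+\sum_{i=1}^{\mu-r}\mathbb D_{i+r}\,\theta^{iq^{d-m}}\right).$$ -/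

import Mathlib

open Polynomial Filter Topology

open scoped NNReal

noncomputable section

namespace TwistedHarmonic

/-! ### The field `C_∞` -/

section Fields

variable (Fq : Type*) [Field Fq]

/-- Equality of rational functions is decided classically. -/
instance decEqRatFunc : DecidableEq (RatFunc Fq) := Classical.decEq _

/-- The completion `K_∞` of `K = F_q(θ)` at the infinite place `1/θ`. -/
abbrev KInf : Type _ := RatFunc.CompletionAtInfty Fq

instance : CompleteSpace (KInf Fq) :=
  letI : UniformSpace (RatFunc Fq) := (RatFunc.inftyValued Fq).toUniformSpace
  inferInstanceAs (CompleteSpace (UniformSpace.Completion (RatFunc Fq)))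

/-- The valuation at infinity of `θ`. -/
theorem valued_theta :
    Valued.v (algebraMap (RatFunc Fq) (KInf Fq) RatFunc.X) = WithZero.exp (1 : ℤ) := by
  refine Eq.trans ?_ (RatFunc.inftyValuation.X Fq)
  exact @Valued.extensionValuation_apply_coe _ _ _ _ (RatFunc.inftyValued Fq) RatFunc.X

variable [Fintype Fq]

/-- The real-valued absolute value on `K_∞` is normalized by `|θ| = q`. -/
instance : (Valued.v : Valuation (KInf Fq) (WithZero (Multiplicative ℤ))).RankOne where
  hom' := (WithZeroMulInt.toNNReal (e := (Fintype.card Fq : ℝ≥0))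
      (by simp)).comp MonoidWithZeroHom.ValueGroup₀.embedding
  strictMono' := (WithZeroMulInt.toNNReal_strictMono
      (by exact_mod_cast Fintype.one_lt_card)).comp
      MonoidWithZeroHom.ValueGroup₀.embedding_strictMono
  exists_val_nontrivial :=
    ⟨algebraMap (RatFunc Fq) (KInf Fq) RatFunc.X, by rw [valued_theta]; simp⟩

instance : NontriviallyNormedField (KInf Fq) :=
  Valued.toNontriviallyNormedField (KInf Fq) (WithZero (Multiplicative ℤ))

instance : IsUltrametricDist (KInf Fq) :=
  inferInstanceAs (@IsUltrametricDist (KInf Fq)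
    (Valued.toNormedField (KInf Fq) (WithZero (Multiplicative ℤ))).toDist)

/-- An algebraic closure of `K_∞`. -/
abbrev KInfAc : Type _ := AlgebraicClosure (KInf Fq)

/-- The algebraic closure carries the unique extension of the absolute value of `K_∞`. -/
instance : NormedField (KInfAc Fq) := spectralNorm.normedField (KInf Fq) (KInfAc Fq)

instance : IsUltrametricDist (KInfAc Fq) :=
  IsUltrametricDist.isUltrametricDist_of_forall_norm_add_le_max_norm
    (isNonarchimedean_spectralNorm (K := KInf Fq) (L := KInfAc Fq))

/-- `C_∞`, the completion of an algebraic closure of `K_∞`. -/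
abbrev CInf : Type _ := UniformSpace.Completion (KInfAc Fq)

instance : IsUltrametricDist (CInf Fq) :=
  IsUltrametricDist.isUltrametricDist_of_forall_norm_add_le_max_norm fun x y => by
    refine UniformSpace.Completion.induction_on₂ x y
      (isClosed_le (by fun_prop) (by fun_prop)) fun a b => ?_
    rw [← UniformSpace.Completion.coe_add, UniformSpace.Completion.norm_coe,
      UniformSpace.Completion.norm_coe, UniformSpace.Completion.norm_coe]
    exact IsUltrametricDist.norm_add_le_max a b

/-- The embedding `K → C_∞`. -/
def KtoC : RatFunc Fq →+* CInf Fq :=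
  (UniformSpace.Completion.coeRingHom (α := KInfAc Fq)).comp
    ((algebraMap (KInf Fq) (KInfAc Fq)).comp (algebraMap (RatFunc Fq) (KInf Fq)))

/-- `θ` as an element of `C_∞`. -/
def theta : CInf Fq := KtoC Fq RatFunc.X

theorem norm_theta : ‖theta Fq‖ = Fintype.card Fq := by
  have h1 : ‖theta Fq‖ = ‖algebraMap (RatFunc Fq) (KInf Fq) RatFunc.X‖ :=
    (UniformSpace.Completion.norm_coe _).trans (spectralNorm_extends _)
  have h2 : ‖algebraMap (RatFunc Fq) (KInf Fq) RatFunc.X‖ =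
      (WithZeroMulInt.toNNReal (e := (Fintype.card Fq : ℝ≥0)) (by simp)
        (MonoidWithZeroHom.ValueGroup₀.embedding (Valued.v.restrict
          (algebraMap (RatFunc Fq) (KInf Fq) RatFunc.X))) : ℝ≥0) := rfl
  have h3 : MonoidWithZeroHom.ValueGroup₀.embedding (Valued.v.restrict
      (algebraMap (RatFunc Fq) (KInf Fq) RatFunc.X)) = WithZero.exp (1 : ℤ) :=
    (MonoidWithZeroHom.ValueGroup₀.embedding_restrict₀ _).trans (valued_theta Fq)
  have h4 : WithZero.exp (1 : ℤ) ≠ 0 := by simp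
  rw [h1, h2, h3, WithZeroMulInt.toNNReal_neg_apply _ h4]
  have h5 : Multiplicative.toAdd (WithZero.unzero h4) = 1 := rfl
  rw [h5]
  simp

end Fields

/-! ### The Tate algebra `T_s` -/

section Tate

variable (C : Type*) [NormedField C] (s : ℕ)

/-- The polynomial ring `C[t_1, …, t_s]`, to be normed by the Gauss norm. -/
def GaussPoly : Type _ := MvPolynomial (Fin s) C

instance : CommRing (GaussPoly C s) := inferInstanceAs (CommRing (MvPolynomial (Fin s) C))

variable {C s} in
/-- The Gauss norm: the maximum of the absolute values of the coefficients. -/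
def gaussNNNorm (f : MvPolynomial (Fin s) C) : ℝ≥0 := f.support.sup fun n => ‖f.coeff n‖₊

variable {C s} in
theorem gaussNNNorm_le_iff (f : MvPolynomial (Fin s) C) (c : ℝ≥0) :
    gaussNNNorm f ≤ c ↔ ∀ n, ‖f.coeff n‖₊ ≤ c := by
  simp only [gaussNNNorm, Finset.sup_le_iff, MvPolynomial.mem_support_iff]
  refine ⟨fun h n => ?_, fun h n _ => h n⟩
  by_cases hn : f.coeff n = 0
  · simp [hn]
  · exact h n hn

variable {C s} in
theorem nnnorm_coeff_le (f : MvPolynomial (Fin s) C) (n : Fin s →₀ ℕ) :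
    ‖f.coeff n‖₊ ≤ gaussNNNorm f := (gaussNNNorm_le_iff f _).1 le_rfl n

variable [IsUltrametricDist C]

instance : NormedCommRing (GaussPoly C s) where
  norm f := (gaussNNNorm (C := C) (s := s) f : ℝ)
  dist f g := (gaussNNNorm (C := C) (s := s) (f - g) : ℝ)
  dist_self f := by
    have : gaussNNNorm (C := C) (s := s) 0 = 0 := by simp [gaussNNNorm]
    rw [sub_self]; exact_mod_cast this
  dist_comm f g := by
    rw [NNReal.coe_inj]
    have h (a : MvPolynomial (Fin s) C) : gaussNNNorm (-a) = gaussNNNorm a := by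
      simp [gaussNNNorm]
    rw [← neg_sub]; exact h _
  dist_triangle f g k := by
    have h (a b : MvPolynomial (Fin s) C) :
        gaussNNNorm (a + b) ≤ gaussNNNorm a + gaussNNNorm b := by
      rw [gaussNNNorm_le_iff]
      intro n
      rw [MvPolynomial.coeff_add]
      exact (nnnorm_add_le _ _).trans (add_le_add (nnnorm_coeff_le _ _) (nnnorm_coeff_le _ _))
    have := h (f - g) (g - k)
    rw [← sub_add_sub_cancel f g k]
    exact_mod_cast this
  eq_of_dist_eq_zero {f g} h := by
    have h0 : gaussNNNorm (C := C) (s := s) (f - g) ≤ 0 := by exact_mod_cast h.le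
    have h1 (a : MvPolynomial (Fin s) C) (ha : gaussNNNorm a ≤ 0) : a = 0 :=
      MvPolynomial.ext _ _ fun n => by simpa using (gaussNNNorm_le_iff a 0).1 ha n
    exact sub_eq_zero.1 (h1 _ h0)
  dist_eq f g := by
    rw [NNReal.coe_inj]
    have h (a : MvPolynomial (Fin s) C) : gaussNNNorm (-a) = gaussNNNorm a := by
      simp [gaussNNNorm]
    rw [← neg_sub, neg_add_eq_sub, ← neg_sub]; exact h _
  norm_mul_le f g := by
    have h (a b : MvPolynomial (Fin s) C) :
        gaussNNNorm (a * b) ≤ gaussNNNorm a * gaussNNNorm b := by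
      classical
      rw [gaussNNNorm_le_iff]
      intro n
      rw [MvPolynomial.coeff_mul]
      refine IsUltrametricDist.nnnorm_sum_le_of_forall_le fun i _ => ?_
      rw [nnnorm_mul]
      exact mul_le_mul' (nnnorm_coeff_le _ _) (nnnorm_coeff_le _ _)
    exact_mod_cast h f g

instance : NormOneClass (GaussPoly C s) where
  norm_one := by
    have h : gaussNNNorm (1 : MvPolynomial (Fin s) C) = 1 := by
      classical
      refine le_antisymm ((gaussNNNorm_le_iff _ _).2 fun n => ?_) ?_
      · rw [MvPolynomial.coeff_one]
        split_ifs <;> simp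
      · simpa using nnnorm_coeff_le (1 : MvPolynomial (Fin s) C) 0
    exact congrArg NNReal.toReal h

/-- The Tate algebra in `t_1, …, t_s` over `C`: the completion of `C[t_1, …, t_s]` for the Gauss
norm. -/
abbrev Tate : Type _ := UniformSpace.Completion (GaussPoly C s)

instance : NormOneClass (Tate C s) where
  norm_one := by
    rw [← UniformSpace.Completion.coe_one, UniformSpace.Completion.norm_coe, norm_one]

/-- The inclusion of `C[t_1, …, t_s]` in the Tate algebra. -/
def polyToTate : MvPolynomial (Fin s) C →+* Tate C s :=
  UniformSpace.Completion.coeRingHom (α := GaussPoly C s)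

end Tate
/-! ### Power sums and harmonic sums -/

section Sums

variable (Fq : Type*) [Field Fq] [Fintype Fq] (s : ℕ)

theorem finite_monic (d : ℕ) : {a : Fq[X] | a.Monic ∧ a.natDegree = d}.Finite := by
  refine (Set.finite_range fun c : Fin (d + 1) → Fq =>
    ∑ i : Fin (d + 1), C (c i) * X ^ (i : ℕ)).subset ?_
  rintro a ⟨-, rfl⟩
  refine ⟨fun i => a.coeff i, ?_⟩
  change ∑ i : Fin (a.natDegree + 1), C (a.coeff i) * X ^ (i : ℕ) = a
  rw [Fin.sum_univ_eq_sum_range (fun i => C (a.coeff i) * X ^ i) (a.natDegree + 1)]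
  exact a.as_sum_range_C_mul_X_pow.symm

/-- `A⁺(d)`, the monic polynomials of degree `d` in `A = F_q[θ]`. -/
def monicOfDegree (d : ℕ) : Finset Fq[X] := (finite_monic Fq d).toFinset

/-- `S_d(n; s) = ∑_{a ∈ A⁺(d)} a(t_1) ⋯ a(t_s) / a ^ n`. -/
def powerSum (d : ℕ) (n : ℤ) : MvPolynomial (Fin s) (RatFunc Fq) :=
  ∑ a ∈ monicOfDegree Fq d,
    MvPolynomial.C (algebraMap Fq[X] (RatFunc Fq) a ^ (-n)) *
      ∏ j : Fin s, aeval (MvPolynomial.X j : MvPolynomial (Fin s) (RatFunc Fq)) a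

/-- `F_d(n; s) = ∑_{i < d} S_i(n; s)`. -/
def harmonicSum (d : ℕ) (n : ℤ) : MvPolynomial (Fin s) (RatFunc Fq) :=
  ∑ i ∈ Finset.range d, powerSum Fq s i n

/-- `l_d = (θ - θ^q) ⋯ (θ - θ^{q^d})`. -/
def lPoly (d : ℕ) : Fq[X] := ∏ k ∈ Finset.Icc 1 d, (X - X ^ Fintype.card Fq ^ k)

/-- `b_i(Y) = (Y - θ)(Y - θ^q) ⋯ (Y - θ^{q^{i-1}})`. -/
def bPoly (i : ℕ) : Fq[X][X] := ∏ k ∈ Finset.range i, (X - C (X ^ Fintype.card Fq ^ k))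

/-- `m = ⌊(s - 1) / (q - 1)⌋`. -/
def mIdx : ℕ := (s - 1) / (Fintype.card Fq - 1)

/-- `μ = (q^m - 1) / (q - 1) - m`. -/
def muIdx : ℕ :=
  (Fintype.card Fq ^ mIdx Fq s - 1) / (Fintype.card Fq - 1) - mIdx Fq s

/-- `Π_{s,d} = b_{d-m}(t_1) ⋯ b_{d-m}(t_s) / l_{d-1}`, for `d ≥ max 1 m`. -/
def PiFactor (d : ℕ) : MvPolynomial (Fin s) (RatFunc Fq) :=
  MvPolynomial.C (algebraMap Fq[X] (RatFunc Fq) (lPoly Fq (d - 1)))⁻¹ *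
    ∏ j : Fin s, aeval (MvPolynomial.X j : MvPolynomial (Fin s) (RatFunc Fq))
      (bPoly Fq (d - mIdx Fq s))

variable {s} in
/-- `P|_{Y = θ^{q^k}}`, for `P ∈ A[t_1, …, t_s][Y]`. -/
def evalY (P : (MvPolynomial (Fin s) Fq[X])[X]) (k : ℕ) : MvPolynomial (Fin s) Fq[X] :=
  P.eval (MvPolynomial.C (X ^ Fintype.card Fq ^ k))

/-- The property that characterizes `H_s`: the identity
`F_d(1; s) = Π_{s,d} · H_s|_{Y = θ^{q^{d-m}}}` for all `d ≥ max 1 m`. -/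
def IsUniversal (H : (MvPolynomial (Fin s) Fq[X])[X]) : Prop :=
  ∀ d : ℕ, 1 ≤ d → mIdx Fq s ≤ d →
    harmonicSum Fq s d 1 = PiFactor Fq s d *
      MvPolynomial.map (algebraMap Fq[X] (RatFunc Fq)) (evalY Fq H (d - mIdx Fq s))

end Sums

/-! ### The functions in the Tate algebra -/

section Functions

variable (Fq : Type*) [Field Fq] [Fintype Fq] (s : ℕ)

/-- The Tate algebra `T_s` over `C_∞`. -/
abbrev Ts : Type _ := Tate (CInf Fq) s

/-- Constants in the Tate algebra. -/
def tConst : CInf Fq →+* Ts Fq s := (polyToTate (CInf Fq) s).comp MvPolynomial.C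

variable {s} in
/-- The variable `t_j` in the Tate algebra. -/
def tVar (j : Fin s) : Ts Fq s := polyToTate (CInf Fq) s (MvPolynomial.X j)

/-- The inclusion of `K[t_1, …, t_s]` in the Tate algebra. -/
def ofKPoly : MvPolynomial (Fin s) (RatFunc Fq) →+* Ts Fq s :=
  (polyToTate (CInf Fq) s).comp (MvPolynomial.map (KtoC Fq))

/-- The inclusion of `A[t_1, …, t_s]` in the Tate algebra. -/
def ofAPoly : MvPolynomial (Fin s) Fq[X] →+* Ts Fq s :=
  (ofKPoly Fq s).comp (MvPolynomial.map (algebraMap Fq[X] (RatFunc Fq)))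

theorem norm_polyToTate (f : MvPolynomial (Fin s) (CInf Fq)) :
    ‖polyToTate (CInf Fq) s f‖ = gaussNNNorm f := UniformSpace.Completion.norm_coe _

theorem norm_term_le (c : CInf Fq) (j : Fin s) : ‖tConst Fq s c * tVar Fq j‖ ≤ ‖c‖ := by
  have h : tConst Fq s c * tVar Fq j =
      polyToTate (CInf Fq) s (MvPolynomial.C c * MvPolynomial.X j) := by
    simp [tConst, tVar]
  rw [h, norm_polyToTate, ← coe_nnnorm, NNReal.coe_le_coe, gaussNNNorm_le_iff]
  intro n
  classical
  rw [MvPolynomial.coeff_C_mul, MvPolynomial.coeff_X]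
  split_ifs <;> simp

/-- The infinite product in the definition of `ω(t_j)` converges in the Tate algebra. -/
theorem multipliable_omega (j : Fin s) : Multipliable fun i : ℕ =>
    (1 - tConst Fq s (theta Fq ^ Fintype.card Fq ^ i)⁻¹ * tVar Fq j) := by
  simp_rw [sub_eq_add_neg]
  refine multipliable_one_add_of_summable ?_
  have hq : (1 : ℝ) < Fintype.card Fq := by exact_mod_cast Fintype.one_lt_card
  refine Summable.of_nonneg_of_le (fun _ => norm_nonneg _) (fun i => ?_)
    (summable_geometric_of_lt_one (r := (Fintype.card Fq : ℝ)⁻¹) (by positivity)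
      (inv_lt_one_of_one_lt₀ hq))
  rw [norm_neg]
  refine (norm_term_le Fq s _ j).trans ?_
  rw [norm_inv, norm_pow, norm_theta, inv_pow]
  exact inv_anti₀ (by positivity)
    (pow_le_pow_right₀ hq.le (Nat.lt_pow_self Fintype.one_lt_card).le)

/-- The infinite product in the definition of `π̃` converges. -/
theorem multipliable_pi (d : ℕ) (hd : 1 ≤ d) : Multipliable fun i : ℕ =>
    (1 - theta Fq / theta Fq ^ Fintype.card Fq ^ (i + d)) := by
  simp_rw [sub_eq_add_neg]
  refine multipliable_one_add_of_summable ?_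
  have hq : (1 : ℝ) < Fintype.card Fq := by exact_mod_cast Fintype.one_lt_card
  refine Summable.of_nonneg_of_le (fun _ => norm_nonneg _) (fun i => ?_)
    (summable_geometric_of_lt_one (r := (Fintype.card Fq : ℝ)⁻¹) (by positivity)
      (inv_lt_one_of_one_lt₀ hq))
  have h0 : (0:ℝ) < Fintype.card Fq := by linarith
  rw [norm_neg, norm_div, norm_pow, norm_theta, inv_pow, div_le_iff₀ (by positivity),
    inv_mul_eq_div, le_div_iff₀ (by positivity), ← pow_succ']
  exact pow_le_pow_right₀ hq.le
    ((Nat.lt_pow_self (n := i+1) Fintype.one_lt_card).le.trans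
      (Nat.pow_le_pow_right Fintype.card_pos (by omega)))

variable {s} in
/-- The Anderson-Thakur function `ω(t_j) = (-θ)^{1/(q-1)} ∏_{i ≥ 0} (1 - t_j / θ^{q^i})⁻¹`, where
`lam` is the chosen root `(-θ)^{1/(q-1)}`. -/
def omega (lam : CInf Fq) (j : Fin s) : Ts Fq s :=
  tConst Fq s lam *
    Ring.inverse (∏' i : ℕ, (1 - tConst Fq s (theta Fq ^ Fintype.card Fq ^ i)⁻¹ * tVar Fq j))

/-- The fundamental period
`π̃ = θ (-θ)^{1/(q-1)} ∏_{i ≥ 1} (1 - θ / θ^{q^i})⁻¹` of the Carlitz exponential, where `lam` is the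
chosen root `(-θ)^{1/(q-1)}`. -/
def piTilde (lam : CInf Fq) : CInf Fq :=
  theta Fq * lam *
    (∏' i : ℕ, (1 - theta Fq / theta Fq ^ Fintype.card Fq ^ (i + 1)))⁻¹

/-- `Γ_d = ∏_{i ≥ d-m} ∏_j (1 - t_j / θ^{q^i}) / ∏_{i ≥ d} (1 - θ / θ^{q^i})`, for `d ≥ max 1 m`. -/
def GammaProd (d : ℕ) : Ts Fq s :=
  (∏' i : ℕ, ∏ j : Fin s,
    (1 - tConst Fq s (theta Fq ^ Fintype.card Fq ^ (i + (d - mIdx Fq s)))⁻¹ * tVar Fq j)) *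
  tConst Fq s (∏' i : ℕ, (1 - theta Fq / theta Fq ^ Fintype.card Fq ^ (i + d)))⁻¹

end Functions

/-! ### The polynomials `Γ_{s,r}` -/

section GammaPoly

variable (Fq : Type*) [Field Fq] [Fintype Fq] (s : ℕ)

/-- The coefficient of `Y^n` in `∏_{i ≥ 0} (1 - c Y^{q^i})`: it is `(-c)^{ℓ(n)}`, with `ℓ(n)` the
sum of the base `q` digits of `n`, if these digits are all `0` or `1`, and `0` otherwise. -/
def digitCoeff {R : Type*} [CommRing R] (q : ℕ) (c : R) (n : ℕ) : R :=
  if ∀ x ∈ Nat.digits q n, x ≤ 1 then (-c) ^ (Nat.digits q n).sum else 0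

/-- The series `∏_{j} ∏_{i ≥ 0} (1 - t_j Y^{q^i})` in `A[t_1, …, t_s][[Y]]`. -/
def seriesF : PowerSeries (MvPolynomial (Fin s) Fq[X]) :=
  ∏ j : Fin s, PowerSeries.mk (digitCoeff (Fintype.card Fq) (MvPolynomial.X j))

/-- The series `∏_{i ≥ 0} (1 - θ Y^{q^{m+i}})` in `A[t_1, …, t_s][[Y]]`. -/
def seriesG : PowerSeries (MvPolynomial (Fin s) Fq[X]) :=
  PowerSeries.mk fun n =>
    if Fintype.card Fq ^ mIdx Fq s ∣ n then
      digitCoeff (Fintype.card Fq) (MvPolynomial.C X) (n / Fintype.card Fq ^ mIdx Fq s)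
    else 0

/-- The quotient of the two series, whose value at `Y = θ^{-q^{d-m}}` is `Γ_d`. -/
def seriesH : PowerSeries (MvPolynomial (Fin s) Fq[X]) :=
  seriesF Fq s * PowerSeries.invOfUnit (seriesG Fq s) 1

/-- `Γ_{s,r}`, the polynomial part in `Y` of `Y^{μ-r} h(1/Y)`, where `h = ∑ h_k Y^k` is the
series expansion of `Γ_d`. -/
def GammaPoly (r : ℕ) : (MvPolynomial (Fin s) Fq[X])[X] :=
  ∑ k ∈ Finset.range (muIdx Fq s - r + 1),
    C (PowerSeries.coeff k (seriesH Fq s)) * X ^ (muIdx Fq s - r - k)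

end GammaPoly

end TwistedHarmonic

end

open TwistedHarmonic

noncomputable section

namespace TwistedHarmonic

/-! ### Carlitz polynomials and Newton expansion at the nodes θ^{q^k} -/

section CarlitzE

variable (Fq : Type*) [Field Fq]

/-! Write Y = θ^{q^{d-m}} and A(<d) for the polynomials of degree less than d. An algebraic half
produces H as a polynomial in Y; an analytic half reads its coefficients off a product formula.

Algebra. The Carlitz polynomials E_k are F_q-linear, vanish on A(<k), and give the expansion a(t) =
∑_k E_k(a) b_k(t) (`aeval_eq_sum_evalE`). Because s ≡ 1 mod q-1, the sum over monic a is minus the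
sum over all nonzero a in A(<d), so F_d(1;s) = ∑_κ Λ_d(∏_j E_{κ_j}) ∏_j b_{κ_j}(t_j). A
Chevalley–Warning degree count kills every κ with some κ_j < d-m
(`harmonicFunctional_prod_eq_zero`), and for the others b_{d-m+k}(t) is b_{d-m}(t) times a
polynomial in t and Y. The relation E_k^q = E_k + [k+1] E_{k+1} lowers the number of factors until
the product has degree less than q^d, where Λ_d merely takes the coefficient of X. Since E_k has
linear coefficient 1/l_k, the number l_{d-1} Λ_d(∏_j E_{κ_j}) is a polynomial in Y independent of d
(`exists_eval_eq_harmonicFunctional`). Infinitely many values of Y make H unique.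

Analysis. Put U = ω(t_1)⋯ω(t_s)/π̃. The infinite products telescope to U Π_{s,d} Γ_d Y^μ = -1
(`omega_mul_PiFactor_mul_GammaProd`), μ being the exponent that balances the powers of θ. Hence U
F_d Y^{μ-r} Γ_d = -Y^{-r} H(Y). After the positive powers of Y are removed, Y^{-r} H(Y) tends to the
coefficient D_r. On the left, Y^{μ-r} Γ_d may be replaced by its polynomial part Γ_{s,r}(Y): the
error is O(1/Y) (`exists_norm_GammaProd_sub_le`) and F_d has Gauss norm 1. The same identity with r
= μ forces deg H = μ, because Γ_d → 1 and U is a unit. -/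

theorem ratFunc_X_pow_injective : Function.Injective fun n : ℕ => (RatFunc.X : RatFunc Fq) ^ n := by
  intro a b h
  have h' : algebraMap Fq[X] (RatFunc Fq) (X ^ a) = algebraMap Fq[X] (RatFunc Fq) (X ^ b) := by
    simpa using h
  have := congrArg natDegree (IsFractionRing.injective Fq[X] (RatFunc Fq) h')
  simpa using this

theorem eq_sum_smul_X_pow {a : Fq[X]} {d : ℕ} (h : a.degree < d) :
    a = ∑ i ∈ Finset.range d, a.coeff i • (X : Fq[X]) ^ i := by
  simp only [smul_eq_C_mul]
  rcases eq_or_ne a 0 with rfl | h0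
  · simp
  · exact a.as_sum_range' d ((natDegree_lt_iff_degree_lt h0).2 h) |>.trans
      (by simp [C_mul_X_pow_eq_monomial])

theorem algebraMap_smul_X_pow (c : Fq) (i : ℕ) :
    algebraMap Fq[X] (RatFunc Fq) (c • (X : Fq[X]) ^ i) = c • (RatFunc.X : RatFunc Fq) ^ i := by
  rw [Algebra.smul_def, map_mul, Algebra.smul_def, map_pow, RatFunc.algebraMap_X,
    ← IsScalarTower.algebraMap_apply]

theorem algebraMap_mvPolynomial_eq_C {s : ℕ} (a : Fq[X]) :
    algebraMap Fq[X] (MvPolynomial (Fin s) (RatFunc Fq)) a =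
      MvPolynomial.C (algebraMap Fq[X] (RatFunc Fq) a) := by
  rw [IsScalarTower.algebraMap_apply Fq[X] (RatFunc Fq)]; rfl

variable [Fintype Fq]

/-- `[k] = θ^{q^k} - θ`. -/
def bracket (k : ℕ) : RatFunc Fq := RatFunc.X ^ Fintype.card Fq ^ k - RatFunc.X

theorem bracket_succ_ne_zero (k : ℕ) : bracket Fq (k + 1) ≠ 0 := by
  intro h
  have h1 : (RatFunc.X : RatFunc Fq) ^ Fintype.card Fq ^ (k + 1) = RatFunc.X ^ 1 := by
    rw [pow_one]; exact sub_eq_zero.1 h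
  have h2 := ratFunc_X_pow_injective Fq h1
  have h3 : 1 < Fintype.card Fq ^ (k + 1) := Nat.one_lt_pow (by omega) Fintype.one_lt_card
  omega

theorem lPoly_zero : lPoly Fq 0 = 1 := by simp [lPoly]

theorem lPoly_succ (d : ℕ) :
    lPoly Fq (d + 1) = lPoly Fq d * (X - X ^ Fintype.card Fq ^ (d + 1)) := by
  rw [lPoly, lPoly, Finset.prod_Icc_succ_top (by omega)]

theorem algebraMap_lPoly_succ (d : ℕ) :
    algebraMap Fq[X] (RatFunc Fq) (lPoly Fq (d + 1)) =
      algebraMap Fq[X] (RatFunc Fq) (lPoly Fq d) * (-bracket Fq (d + 1)) := by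
  rw [lPoly_succ, map_mul]; simp [bracket]

theorem algebraMap_lPoly_ne_zero (d : ℕ) : algebraMap Fq[X] (RatFunc Fq) (lPoly Fq d) ≠ 0 := by
  induction d with
  | zero => simp [lPoly_zero]
  | succ d ih =>
    rw [algebraMap_lPoly_succ]
    exact mul_ne_zero ih (neg_ne_zero.2 (bracket_succ_ne_zero Fq d))

/-- The normalized Carlitz polynomials `E_k`, with `E_k^q = E_k + [k+1] E_{k+1}`. -/
def carlitzE : ℕ → (RatFunc Fq)[X]
  | 0 => X
  | k + 1 => C (bracket Fq (k + 1))⁻¹ * (carlitzE k ^ Fintype.card Fq - carlitzE k)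

theorem carlitzE_pow (k : ℕ) : carlitzE Fq k ^ Fintype.card Fq =
    carlitzE Fq k + C (bracket Fq (k + 1)) * carlitzE Fq (k + 1) := by
  rw [carlitzE, ← mul_assoc, ← C_mul, mul_inv_cancel₀ (bracket_succ_ne_zero Fq k)]
  simp

theorem add_pow_card {R : Type*} [CommRing R] [Algebra Fq R] (x y : R) :
    (x + y) ^ Fintype.card Fq = x ^ Fintype.card Fq + y ^ Fintype.card Fq :=
  map_add (FiniteField.frobeniusAlgHom Fq R) x y

theorem sum_pow_card {R ι : Type*} [CommRing R] [Algebra Fq R] (t : Finset ι) (f : ι → R) :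
    (∑ i ∈ t, f i) ^ Fintype.card Fq = ∑ i ∈ t, f i ^ Fintype.card Fq :=
  map_sum (FiniteField.frobeniusAlgHom Fq R) f t

/-- The q-power map preserves sums of monomials X^{q^i}, so the recursion never leaves them. Only
-E_k contributes to the linear term of E_{k+1}, which gives the recursion of 1/l_k. -/
theorem carlitzE_eq_sum (k : ℕ) : ∃ c : ℕ → RatFunc Fq,
    c 0 = (algebraMap Fq[X] (RatFunc Fq) (lPoly Fq k))⁻¹ ∧
    carlitzE Fq k = ∑ i ∈ Finset.range (k + 1), C (c i) * X ^ Fintype.card Fq ^ i := by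
  induction k with
  | zero => exact ⟨fun _ => 1, by simp [lPoly_zero], by simp [carlitzE]⟩
  | succ k ih =>
    obtain ⟨c, hc0, hc⟩ := ih
    let b := (bracket Fq (k + 1))⁻¹
    refine ⟨fun i => b * ((if i = 0 then 0 else c (i - 1) ^ Fintype.card Fq) -
      if i ≤ k then c i else 0), ?_, ?_⟩
    · simp [hc0, b, algebraMap_lPoly_succ, mul_comm]
    · rw [carlitzE, hc, sum_pow_card]
      simp only [mul_sub, C_sub, sub_mul, C_mul, Finset.sum_sub_distrib, Finset.mul_sum]
      congr 1
      · rw [Finset.sum_range_succ' _ (k + 1)]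
        simp only [mul_pow, ← C_pow, ← pow_mul, ← pow_succ]
        simp [mul_assoc, b]
      · rw [Finset.sum_range_succ _ (k + 1)]
        simp only [Nat.not_succ_le_self, if_false]
        simp only [C_0, mul_zero, zero_mul, add_zero]
        refine Finset.sum_congr rfl fun i hi => ?_
        rw [if_pos (by simpa [Nat.lt_succ_iff] using hi), mul_assoc]

theorem natDegree_carlitzE_le (k : ℕ) : (carlitzE Fq k).natDegree ≤ Fintype.card Fq ^ k := by
  obtain ⟨c, -, hc⟩ := carlitzE_eq_sum Fq k
  rw [hc]
  refine natDegree_sum_le_of_forall_le _ _ fun i hi => ?_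
  refine (natDegree_C_mul_X_pow_le _ _).trans ?_
  exact Nat.pow_le_pow_right Fintype.card_pos (by simpa [Nat.lt_succ_iff] using hi)

theorem coeff_zero_carlitzE (k : ℕ) : (carlitzE Fq k).coeff 0 = 0 := by
  obtain ⟨c, -, hc⟩ := carlitzE_eq_sum Fq k
  rw [hc, finsetSum_coeff]
  refine Finset.sum_eq_zero fun i _ => ?_
  have : 0 ≠ Fintype.card Fq ^ i := (pow_pos Fintype.card_pos i).ne
  rw [coeff_C_mul_X_pow, if_neg this]

theorem coeff_one_carlitzE (k : ℕ) :
    (carlitzE Fq k).coeff 1 = (algebraMap Fq[X] (RatFunc Fq) (lPoly Fq k))⁻¹ := by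
  obtain ⟨c, hc0, hc⟩ := carlitzE_eq_sum Fq k
  rw [hc, finsetSum_coeff, Finset.sum_eq_single 0]
  · simp [hc0]
  · intro i _ hi
    have : 1 ≠ Fintype.card Fq ^ i := (Nat.one_lt_pow hi Fintype.one_lt_card).ne
    rw [coeff_C_mul_X_pow, if_neg this]
  · simp

theorem eval_carlitzE_add (k : ℕ) (x y : RatFunc Fq) :
    (carlitzE Fq k).eval (x + y) = (carlitzE Fq k).eval x + (carlitzE Fq k).eval y := by
  induction k with
  | zero => simp [carlitzE]
  | succ k ih =>
    simp only [carlitzE, eval_mul, eval_C, eval_sub, eval_pow, ih, add_pow_card]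
    ring

theorem eval_carlitzE_smul (k : ℕ) (c : Fq) (x : RatFunc Fq) :
    (carlitzE Fq k).eval (c • x) = c • (carlitzE Fq k).eval x := by
  induction k with
  | zero => simp [carlitzE]
  | succ k ih =>
    simp only [carlitzE, eval_mul, eval_C, eval_sub, eval_pow, ih, _root_.smul_pow,
      FiniteField.pow_card, ← smul_sub, mul_smul_comm]

/-- The `F_q`-linear function `x ↦ E_k(x)`. -/
def evalE (k : ℕ) : RatFunc Fq →ₗ[Fq] RatFunc Fq where
  toFun x := (carlitzE Fq k).eval x
  map_add' := eval_carlitzE_add Fq k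
  map_smul' := eval_carlitzE_smul Fq k

theorem evalE_apply (k : ℕ) (x : RatFunc Fq) : evalE Fq k x = (carlitzE Fq k).eval x := rfl

theorem evalE_zero (x : RatFunc Fq) : evalE Fq 0 x = x := by simp [evalE_apply, carlitzE]

theorem evalE_pow (k : ℕ) (x : RatFunc Fq) : evalE Fq k x ^ Fintype.card Fq =
    evalE Fq k x + bracket Fq (k + 1) * evalE Fq (k + 1) x := by
  have := congrArg (eval x) (carlitzE_pow Fq k)
  simpa [evalE_apply] using this

/-- Raise the formula for index k to the q-th power and rewrite each E^q by the defining recursion;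
cancelling [k+1] or [k+2] gives the next case. This mirrors t b_k = b_{k+1} + θ^{q^k} b_k, and the
Newton expansion follows from the match. -/
theorem evalE_theta_mul (k : ℕ) (x : RatFunc Fq) : evalE Fq (k + 1) (RatFunc.X * x) =
    RatFunc.X ^ Fintype.card Fq ^ (k + 1) * evalE Fq (k + 1) x + evalE Fq k x := by
  induction k with
  | zero =>
    have h := evalE_pow Fq 0 x
    have h' := evalE_pow Fq 0 (RatFunc.X * x)
    refine mul_left_cancel₀ (bracket_succ_ne_zero Fq 0) ?_
    simp only [evalE_zero, zero_add, pow_one, mul_pow] at *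
    rw [h] at h'
    simp only [bracket, pow_one] at *
    linear_combination -h'
  | succ k ih =>
    have h0 := evalE_pow Fq k x
    have h := evalE_pow Fq (k + 1) x
    have h' := evalE_pow Fq (k + 1) (RatFunc.X * x)
    refine mul_left_cancel₀ (bracket_succ_ne_zero Fq (k + 1)) ?_
    rw [ih, add_pow_card, mul_pow, ← pow_mul, ← pow_succ, h, h0] at h'
    simp only [bracket] at *
    linear_combination -h'

theorem evalE_X_pow_eq_zero {k n : ℕ} (h : n < k) : evalE Fq k (RatFunc.X ^ n) = 0 := by
  induction n generalizing k with
  | zero =>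
    rw [pow_zero]
    obtain ⟨k, rfl⟩ := Nat.exists_eq_add_of_lt h
    rw [zero_add]
    induction k with
    | zero =>
      have := evalE_pow Fq 0 1
      simp only [evalE_zero, one_pow] at this
      have h2 := bracket_succ_ne_zero Fq 0
      simpa [h2] using this
    | succ k ih =>
      have := evalE_pow Fq (k + 1) 1
      rw [ih (by omega), zero_pow Fintype.card_ne_zero] at this
      have h2 := bracket_succ_ne_zero Fq (k + 1)
      simpa [h2] using this
  | succ n ih =>
    obtain ⟨k, rfl⟩ : ∃ j, k = j + 1 := ⟨k - 1, by omega⟩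
    rw [pow_succ', evalE_theta_mul, ih (by omega), ih (by omega)]
    simp

theorem bPoly_succ (k : ℕ) :
    bPoly Fq (k + 1) = bPoly Fq k * (X - C (X ^ Fintype.card Fq ^ k)) := by
  rw [bPoly, bPoly, Finset.prod_range_succ]

/-- Multiplication by t shifts the β_k exactly as multiplication by θ shifts the coefficients
E_k(θ^n). The sequence β stands for the images of the b_k in the algebra at hand. -/
theorem X_pow_eq_sum_evalE {B : Type*} [CommRing B] [Algebra (RatFunc Fq) B] (t : B) (β : ℕ → B)
    (hβ0 : β 0 = 1) (hβ : ∀ k, β (k + 1) =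
      β k * (t - algebraMap (RatFunc Fq) B (RatFunc.X ^ Fintype.card Fq ^ k)))
    {n d : ℕ} (h : n < d) :
    t ^ n = ∑ k ∈ Finset.range d, algebraMap (RatFunc Fq) B (evalE Fq k (RatFunc.X ^ n)) * β k := by
  induction n generalizing d with
  | zero =>
    rw [Finset.sum_eq_single 0]
    · simp [evalE_zero, hβ0]
    · intro k _ hk
      rw [evalE_X_pow_eq_zero Fq (by omega)]; simp
    · simp; omega
  | succ n ih =>
    obtain ⟨d, rfl⟩ : ∃ j, d = j + 1 := ⟨d - 1, by omega⟩
    have h1 := ih (d := d) (by omega)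
    have h2 := ih (d := d + 1) (by omega)
    have h3 : t * t ^ n = ∑ k ∈ Finset.range d,
        algebraMap (RatFunc Fq) B (evalE Fq k (RatFunc.X ^ n)) * (t * β k) := by
      rw [h1, Finset.mul_sum]; exact Finset.sum_congr rfl fun k _ => by ring
    have h4 : ∀ k, t * β k = β (k + 1) +
        algebraMap (RatFunc Fq) B (RatFunc.X ^ Fintype.card Fq ^ k) * β k := fun k => by
      rw [hβ]; ring
    rw [pow_succ', h3]
    simp only [h4, mul_add, Finset.sum_add_distrib]
    rw [Finset.sum_range_succ' _ d]
    simp only [pow_succ' _ n, evalE_theta_mul, map_add, add_mul, Finset.sum_add_distrib]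
    rw [add_comm, add_assoc, add_comm (Finset.sum _ _) (algebraMap _ _ _ * _), ← add_assoc]
    congr 1
    -- The extra term k = d vanishes because n < d, so both sums have the same range after the
    -- shift.
    have h5 : ∑ k ∈ Finset.range d, algebraMap (RatFunc Fq) B (evalE Fq k (RatFunc.X ^ n)) *
        (algebraMap (RatFunc Fq) B (RatFunc.X ^ Fintype.card Fq ^ k) * β k) =
      ∑ k ∈ Finset.range (d + 1), algebraMap (RatFunc Fq) B (evalE Fq k (RatFunc.X ^ n)) *
        (algebraMap (RatFunc Fq) B (RatFunc.X ^ Fintype.card Fq ^ k) * β k) := by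
      rw [Finset.sum_range_succ, evalE_X_pow_eq_zero Fq (show n < d by omega)]
      simp
    rw [h5, Finset.sum_range_succ' _ d]
    congr 1
    · exact Finset.sum_congr rfl fun k _ => by rw [map_mul]; ring
    · simp [evalE_zero, map_mul]; ring

theorem aeval_eq_sum_evalE {B : Type*} [CommRing B] [Algebra (RatFunc Fq) B] [Algebra Fq B]
    [IsScalarTower Fq (RatFunc Fq) B] (t : B) (β : ℕ → B)
    (hβ0 : β 0 = 1) (hβ : ∀ k, β (k + 1) =
      β k * (t - algebraMap (RatFunc Fq) B (RatFunc.X ^ Fintype.card Fq ^ k)))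
    {a : Fq[X]} {d : ℕ} (h : a.degree < d) :
    aeval t a = ∑ k ∈ Finset.range d,
      algebraMap (RatFunc Fq) B (evalE Fq k (algebraMap Fq[X] (RatFunc Fq) a)) * β k := by
  have hsm : ∀ (c : Fq) (x : RatFunc Fq),
      algebraMap (RatFunc Fq) B (c • x) = c • algebraMap (RatFunc Fq) B x := fun c x => by
    rw [Algebra.algebraMap_eq_smul_one, smul_assoc, ← Algebra.algebraMap_eq_smul_one]
  rw [eq_sum_smul_X_pow Fq h, map_sum, map_sum]
  simp only [algebraMap_smul_X_pow, map_smul, map_sum, map_pow, aeval_X, hsm, Finset.sum_mul]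
  rw [Finset.sum_comm]
  refine Finset.sum_congr rfl fun i hi => ?_
  rw [X_pow_eq_sum_evalE Fq t β hβ0 hβ (Finset.mem_range.1 hi), Finset.smul_sum]
  exact Finset.sum_congr rfl fun k _ => by rw [smul_mul_assoc]

theorem evalE_eq_zero {a : Fq[X]} {k : ℕ} (h : a.degree < k) :
    evalE Fq k (algebraMap Fq[X] (RatFunc Fq) a) = 0 := by
  rw [eq_sum_smul_X_pow Fq h, map_sum, map_sum]
  refine Finset.sum_eq_zero fun i hi => ?_
  rw [algebraMap_smul_X_pow, map_smul, evalE_X_pow_eq_zero Fq (Finset.mem_range.1 hi), smul_zero]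

end CarlitzE

/-! ### Vanishing of sums of products of linear forms -/

section LinearForms

variable {Fq : Type*} [Field Fq] [Fintype Fq]

/-- A product of fewer than `(q - 1) d` linear forms on `F_q^d` sums to zero. -/
theorem sum_prod_linear_eq_zero {F ι : Type*} [CommRing F] [Algebra Fq F] [Fintype ι] {d : ℕ}
    (L : ι → (Fin d → Fq) →ₗ[Fq] F) (h : Fintype.card ι < (Fintype.card Fq - 1) * d) :
    ∑ v : Fin d → Fq, ∏ i, L i v = 0 := by
  classical
  have hL : ∀ i v, L i v = ∑ k : Fin d, algebraMap Fq F (v k) * L i (Pi.single k 1) := by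
    intro i v
    conv_lhs => rw [pi_eq_sum_univ v, map_sum]
    refine Finset.sum_congr rfl fun k _ => ?_
    rw [← Algebra.smul_def, map_smul]
    congr 2
    ext j
    simp [Pi.single_apply, eq_comm]
  have hprod : ∀ v, ∏ i, L i v = ∑ κ ∈ Fintype.piFinset fun _ : ι => (Finset.univ : Finset (Fin d)),
      (∏ i, algebraMap Fq F (v (κ i))) * ∏ i, L i (Pi.single (κ i) 1) := by
    intro v
    rw [Finset.prod_congr rfl fun i _ => hL i v, Finset.prod_univ_sum]
    simp only [Finset.prod_mul_distrib]
  rw [Finset.sum_congr rfl fun v _ => hprod v]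
  rw [Finset.sum_comm]
  refine Finset.sum_eq_zero fun κ _ => ?_
  rw [← Finset.sum_mul]
  -- Each expanded term is a monomial in d variables of degree less than (q-1)d, so the
  -- Chevalley–Warning summation lemma applies.
  have h1 : ∑ v : Fin d → Fq, ∏ i, v (κ i) = 0 := by
    have := MvPolynomial.sum_eval_eq_zero (K := Fq) (∏ i, MvPolynomial.X (κ i)) (by
      refine lt_of_le_of_lt (MvPolynomial.totalDegree_finsetProd _ _) ?_
      simpa using h)
    simpa [map_prod] using this
  have h2 : ∑ v : Fin d → Fq, ∏ i, algebraMap Fq F (v (κ i)) = 0 := by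
    rw [← map_zero (algebraMap Fq F), ← h1, map_sum]
    simp only [map_prod]
  rw [h2, zero_mul]

end LinearForms

/-! ### The functional Λ_d: values in low degree and vanishing -/

section LowDegree

variable (Fq : Type*) [Field Fq]

/-- The polynomial of degree less than `d` with coefficient vector `v`. -/
def vecPoly (d : ℕ) : (Fin d → Fq) →ₗ[Fq] Fq[X] :=
  (degreeLT Fq d).subtype.comp (degreeLTEquiv Fq d).symm.toLinearMap

theorem degree_vecPoly_lt (d : ℕ) (v : Fin d → Fq) : (vecPoly Fq d v).degree < d :=
  mem_degreeLT.1 ((degreeLTEquiv Fq d).symm v).2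

theorem vecPoly_injective (d : ℕ) : Function.Injective (vecPoly Fq d) :=
  Subtype.val_injective.comp (degreeLTEquiv Fq d).symm.injective

theorem exists_vecPoly_eq {d : ℕ} {a : Fq[X]} (h : a.degree < d) : ∃ v, vecPoly Fq d v = a :=
  ⟨degreeLTEquiv Fq d ⟨a, mem_degreeLT.2 h⟩, by simp [vecPoly]⟩

/-- The polynomial with coefficient vector `v`, as an element of `K`. -/
def vecRat (d : ℕ) : (Fin d → Fq) →ₗ[Fq] RatFunc Fq :=
  (IsScalarTower.toAlgHom Fq Fq[X] (RatFunc Fq)).toLinearMap.comp (vecPoly Fq d)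

theorem vecRat_apply (d : ℕ) (v : Fin d → Fq) :
    vecRat Fq d v = algebraMap Fq[X] (RatFunc Fq) (vecPoly Fq d v) := rfl

theorem vecRat_injective (d : ℕ) : Function.Injective (vecRat Fq d) :=
  (IsFractionRing.injective Fq[X] (RatFunc Fq)).comp (vecPoly_injective Fq d)

variable [Fintype Fq]

/-- A polynomial of degree less than `q^d - 1` sums to zero over `A(<d)`. -/
theorem sum_eval_vecRat_eq_zero (d : ℕ) (p : (RatFunc Fq)[X])
    (hp : p.natDegree + 1 < Fintype.card Fq ^ d) : ∑ v, p.eval (vecRat Fq d v) = 0 := by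
  classical
  have hcard : (Finset.univ : Finset (Fin d → Fq)).card = Fintype.card Fq ^ d := by simp
  have hdeg : p.degree < (Finset.univ : Finset (Fin d → Fq)).card := by
    rw [hcard]
    exact lt_of_le_of_lt degree_le_natDegree (by exact_mod_cast (by omega))
  have h := Lagrange.coeff_eq_sum (s := Finset.univ) (v := vecRat Fq d)
    (vecRat_injective Fq d).injOn hdeg
  rw [coeff_eq_zero_of_natDegree_lt (by rw [hcard]; omega)] at h
  -- The nodes form a group, so j ↦ i - j shows that all Lagrange denominators agree. The
  -- coefficient of index q^d - 1 is therefore a fixed multiple of the sum.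
  have he : ∀ i : Fin d → Fq, ∏ j ∈ Finset.univ.erase i, (vecRat Fq d i - vecRat Fq d j) =
      ∏ j ∈ Finset.univ.erase (0 : Fin d → Fq), vecRat Fq d j := by
    intro i
    refine Finset.prod_nbij' (fun j => i - j) (fun j => i - j) ?_ ?_ ?_ ?_ ?_
    · intro j hj
      simp only [Finset.mem_erase, Finset.mem_univ, and_true, ne_eq, sub_eq_zero] at *
      exact fun h => hj h.symm
    · intro j hj
      simp only [Finset.mem_erase, Finset.mem_univ, and_true, ne_eq] at *
      simpa using hj
    · simp
    · simp
    · simp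
  simp only [he, ← Finset.sum_div] at h
  have hne : ∏ j ∈ Finset.univ.erase (0 : Fin d → Fq), vecRat Fq d j ≠ 0 := by
    rw [Finset.prod_ne_zero_iff]
    intro j hj h0
    exact (Finset.ne_of_mem_erase hj) (vecRat_injective Fq d (by rw [h0, map_zero]))
  exact ((div_eq_zero_iff.1 h.symm).resolve_right hne)

/-- `Λ_d(f) = -∑_{a ∈ A(<d), a ≠ 0} f(a) / a`. -/
def harmonicFunctional (d : ℕ) : (RatFunc Fq)[X] →ₗ[RatFunc Fq] RatFunc Fq :=
  -∑ v : Fin d → Fq, (vecRat Fq d v)⁻¹ • leval (vecRat Fq d v)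

theorem harmonicFunctional_apply (d : ℕ) (f : (RatFunc Fq)[X]) :
    harmonicFunctional Fq d f = -∑ v, (vecRat Fq d v)⁻¹ * f.eval (vecRat Fq d v) := by
  simp [harmonicFunctional, leval_apply]

/-- With f = X p, the sum of f(a)/a over a ≠ 0 is the sum of p(a) over a ≠ 0. The full sum of p
vanishes by degree, which leaves -p(0). -/
theorem harmonicFunctional_eq_coeff_one {d : ℕ} {f : (RatFunc Fq)[X]} (h0 : f.coeff 0 = 0)
    (hf : f.natDegree < Fintype.card Fq ^ d) : harmonicFunctional Fq d f = f.coeff 1 := by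
  classical
  obtain ⟨p, rfl⟩ := X_dvd_iff.2 h0
  have hp : ∑ v, p.eval (vecRat Fq d v) = 0 := by
    rcases eq_or_ne p 0 with rfl | hp0
    · simp
    · refine sum_eval_vecRat_eq_zero Fq d p ?_
      rwa [natDegree_X_mul hp0] at hf
  rw [harmonicFunctional_apply, ← Finset.add_sum_erase _ _ (Finset.mem_univ 0)]
  rw [← Finset.add_sum_erase _ _ (Finset.mem_univ 0)] at hp
  have h1 : ∑ v ∈ Finset.univ.erase 0,
      (vecRat Fq d v)⁻¹ * (X * p).eval (vecRat Fq d v) =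
      ∑ v ∈ Finset.univ.erase 0, p.eval (vecRat Fq d v) := by
    refine Finset.sum_congr rfl fun v hv => ?_
    have : vecRat Fq d v ≠ 0 := fun h =>
      (Finset.ne_of_mem_erase hv) (vecRat_injective Fq d (by rw [h, map_zero]))
    rw [eval_mul, eval_X, inv_mul_cancel_left₀ this]
  rw [h1]
  simp only [map_zero, eval_mul, eval_X, zero_mul, mul_zero, zero_add] at *
  rw [← coeff_zero_eq_eval_zero] at hp
  rw [show (1 : ℕ) = 0 + 1 from rfl, coeff_X_mul]
  linear_combination -hp

theorem harmonicFunctional_mul_carlitzE_eq_zero {d k : ℕ} (h : d ≤ k) (f : (RatFunc Fq)[X]) :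
    harmonicFunctional Fq d (carlitzE Fq k * f) = 0 := by
  rw [harmonicFunctional_apply, Finset.sum_eq_zero, neg_zero]
  intro v _
  have := evalE_eq_zero Fq (a := vecPoly Fq d v) (k := k)
    ((degree_vecPoly_lt Fq d v).trans_le (by exact_mod_cast h))
  rw [eval_mul, ← evalE_apply, vecRat_apply, this]
  simp

/-- For a ≠ 0, a^{q^i}/a = a^{q^i - 1} is the product over u < i of (a^{q^u})^{q-1}, that is, of
(q-1)i linear forms. Together with the L_j this makes (q-1)(i+m) < (q-1)d linear forms. -/
theorem sum_vecRat_inv_mul_pow_mul_eq_zero {ι : Type*} [Fintype ι] [Nonempty ι] {d i m : ℕ}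
    (him : i + m < d)
    (hcard : Fintype.card ι = (Fintype.card Fq - 1) * m) (L : ι → RatFunc Fq →ₗ[Fq] RatFunc Fq) :
    ∑ v, (vecRat Fq d v)⁻¹ * ((vecRat Fq d v) ^ Fintype.card Fq ^ i * ∏ j, L j (vecRat Fq d v)) =
      0 := by
  classical
  have hq : 1 < Fintype.card Fq := Fintype.one_lt_card
  have hgeom : ∀ x : RatFunc Fq, ∏ u : Fin i × Fin (Fintype.card Fq - 1),
      ((FiniteField.frobeniusAlgHom Fq (RatFunc Fq)).toLinearMap ^ (u.1 : ℕ)) x =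
        x ^ (Fintype.card Fq ^ i - 1) := by
    intro x
    have h1 : ∀ n : ℕ, ((FiniteField.frobeniusAlgHom Fq (RatFunc Fq)).toLinearMap ^ n) x =
        x ^ Fintype.card Fq ^ n := by
      intro n
      induction n with
      | zero => simp
      | succ n ih => rw [pow_succ', Module.End.mul_apply, ih]; simp [← pow_mul, pow_succ]
    simp only [h1]
    rw [Fintype.prod_prod_type]
    simp only [Finset.prod_const, Finset.card_univ, Fintype.card_fin, ← pow_mul]
    rw [Finset.prod_pow_eq_pow_sum, Fin.sum_univ_eq_sum_range
      (fun n => Fintype.card Fq ^ n * (Fintype.card Fq - 1)), ← Finset.sum_mul,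
      Nat.geomSum_eq hq, Nat.div_mul_cancel]
    simpa using Nat.sub_dvd_pow_sub_pow (Fintype.card Fq) 1 i
  let L' : (Fin i × Fin (Fintype.card Fq - 1)) ⊕ ι → (Fin d → Fq) →ₗ[Fq] RatFunc Fq :=
    Sum.elim (fun u =>
      ((FiniteField.frobeniusAlgHom Fq (RatFunc Fq)).toLinearMap ^ (u.1 : ℕ)).comp (vecRat Fq d))
      (fun j => (L j).comp (vecRat Fq d))
  have h2 := sum_prod_linear_eq_zero L' (by
    rw [Fintype.card_sum, Fintype.card_prod, hcard, Fintype.card_fin, Fintype.card_fin, mul_comm i,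
      ← mul_add]
    exact Nat.mul_lt_mul_of_pos_left him (by omega))
  rw [← h2]
  refine Finset.sum_congr rfl fun v _ => ?_
  rw [Fintype.prod_sum_type]
  simp only [L', Sum.elim_inl, Sum.elim_inr, LinearMap.comp_apply, hgeom]
  -- At v = 0 the left side is zero. On the right, the power equals 1 when i = 0, so the vanishing
  -- comes from some L_j(0), available because `ι` is nonempty.
  rcases eq_or_ne (vecRat Fq d v) 0 with h0 | h0
  · rw [h0]; simp
  · have : Fintype.card Fq ^ i = (Fintype.card Fq ^ i - 1) + 1 :=
      (Nat.sub_add_cancel (Nat.one_le_pow _ _ (by omega))).symm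
    rw [← mul_assoc]
    congr 1
    conv_lhs => rw [this, pow_succ']
    rw [inv_mul_cancel_left₀ h0]

/-- Expand only the factor E_{κ j₀} into monomials X^{q^i} with i ≤ κ j₀. The other (q-1)m factors
are linear forms, so each monomial satisfies i + m < d and contributes zero. -/
theorem harmonicFunctional_prod_eq_zero {ι : Type*} [Fintype ι] [DecidableEq ι] [Nontrivial ι]
    {d m : ℕ} (hcard : Fintype.card ι = (Fintype.card Fq - 1) * m + 1) (κ : ι → ℕ) (j₀ : ι)
    (hj : κ j₀ + m < d) : harmonicFunctional Fq d (∏ j, carlitzE Fq (κ j)) = 0 := by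
  obtain ⟨c, -, hc⟩ := carlitzE_eq_sum Fq (κ j₀)
  have hne : Nonempty {j // j ≠ j₀} := let ⟨j, hj⟩ := exists_ne j₀; ⟨⟨j, hj⟩⟩
  rw [harmonicFunctional_apply, neg_eq_zero]
  have h1 : ∀ v, (vecRat Fq d v)⁻¹ * (∏ j, carlitzE Fq (κ j)).eval (vecRat Fq d v) =
      ∑ i ∈ Finset.range (κ j₀ + 1), c i * ((vecRat Fq d v)⁻¹ *
        ((vecRat Fq d v) ^ Fintype.card Fq ^ i *
          ∏ j : {j // j ≠ j₀}, evalE Fq (κ j) (vecRat Fq d v))) := by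
    intro v
    rw [eval_prod, ← Finset.mul_prod_erase _ _ (Finset.mem_univ j₀), hc, eval_finsetSum,
      Finset.sum_mul, Finset.mul_sum]
    refine Finset.sum_congr rfl fun i _ => ?_
    have : ∏ j ∈ Finset.univ.erase j₀, (carlitzE Fq (κ j)).eval (vecRat Fq d v) =
        ∏ j : {j // j ≠ j₀}, evalE Fq (κ j) (vecRat Fq d v) := by
      refine Finset.prod_subtype _ (fun x => by simp) _
    rw [this]
    simp only [eval_mul, eval_C, eval_pow, eval_X]
    ring
  simp only [h1]
  rw [Finset.sum_comm]
  refine Finset.sum_eq_zero fun i hi => ?_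
  rw [← Finset.mul_sum, sum_vecRat_inv_mul_pow_mul_eq_zero Fq (m := m) (by
    have := Finset.mem_range.1 hi; omega) (by
    rw [Fintype.card_subtype_compl, hcard]; simp), mul_zero]

end LowDegree

/-! ### Reduction of Λ_d on products to polynomials in Y = θ^{q^{d-m}} -/

section Reduction

variable (Fq : Type*) [Field Fq] [Fintype Fq]

/-- It exhibits l_{d-1}/l_{d-m+i} as a polynomial in Y whose shape does not depend on d. -/
theorem lPoly_pred_eq_mul {d m i : ℕ} (hm : m ≤ d) (hi : i < m) :
    lPoly Fq (d - 1) = lPoly Fq (d - m + i) *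
      ∏ n ∈ Finset.Ico (i + 1) m, (X - (X ^ Fintype.card Fq ^ (d - m)) ^ Fintype.card Fq ^ n) := by
  have h : ∀ n, lPoly Fq n = ∏ k ∈ Finset.Ico 1 (n + 1), (X - X ^ Fintype.card Fq ^ k) := fun n => by
    rw [lPoly]; rfl
  rw [h, h, ← Finset.prod_Ico_consecutive _ (show 1 ≤ d - m + i + 1 by omega)
    (show d - m + i + 1 ≤ d - 1 + 1 by omega)]
  congr 1
  rw [show d - m + i + 1 = i + 1 + (d - m) by omega, show d - 1 + 1 = m + (d - m) by omega,
    ← Finset.prod_Ico_add']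
  refine Finset.prod_congr rfl fun n _ => ?_
  rw [← pow_mul, ← pow_add, add_comm n]

/-- With every digit at most q-1, the degree is at most q^K ∑_{i<m} (q-1) q^i = q^K (q^m - 1). -/
theorem natDegree_prod_carlitzE_lt {S : Multiset ℕ} {m : ℕ} (hm : ∀ i ∈ S, i < m)
    (hc : ∀ i, S.count i < Fintype.card Fq) (K : ℕ) :
    (S.map fun i => carlitzE Fq (K + i)).prod.natDegree < Fintype.card Fq ^ (K + m) := by
  have hq : 1 < Fintype.card Fq := Fintype.one_lt_card
  refine (natDegree_multiset_prod_le _).trans_lt ?_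
  rw [Multiset.map_map]
  have h1 : (S.map (natDegree ∘ fun i => carlitzE Fq (K + i))).sum ≤
      (S.map fun i => Fintype.card Fq ^ (K + i)).sum :=
    Multiset.sum_map_le_sum_map _ _ fun i _ => natDegree_carlitzE_le Fq _
  refine h1.trans_lt ?_
  have hsub : S.toFinset ⊆ Finset.range m := fun i hi =>
    Finset.mem_range.2 (hm i (Multiset.mem_toFinset.1 hi))
  rw [Finset.sum_multiset_map_count, Finset.sum_subset hsub (fun i _ hi => by
    rw [Multiset.count_eq_zero_of_notMem (fun h => hi (Multiset.mem_toFinset.2 h)), zero_smul])]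
  calc ∑ i ∈ Finset.range m, S.count i • Fintype.card Fq ^ (K + i)
      ≤ ∑ i ∈ Finset.range m,
          Fintype.card Fq ^ K * (Fintype.card Fq ^ i * (Fintype.card Fq - 1)) := by
        refine Finset.sum_le_sum fun i _ => ?_
        rw [smul_eq_mul, pow_add, mul_comm, mul_assoc]
        gcongr
        have := hc i; omega
    _ = Fintype.card Fq ^ K * (Fintype.card Fq ^ m - 1) := by
        rw [← Finset.mul_sum, ← Finset.sum_mul, Nat.geomSum_eq hq, Nat.div_mul_cancel]
        simpa using Nat.sub_dvd_pow_sub_pow (Fintype.card Fq) 1 m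
    _ < Fintype.card Fq ^ (K + m) := by
        rw [pow_add]
        refine Nat.mul_lt_mul_of_pos_left ?_ (pow_pos (by omega) _)
        exact Nat.sub_lt (pow_pos (by omega) _) one_pos

theorem coeff_zero_prod_carlitzE {S : Multiset ℕ} (hS : S ≠ 0) (K : ℕ) :
    (S.map fun i => carlitzE Fq (K + i)).prod.coeff 0 = 0 := by
  obtain ⟨i, hi⟩ := Multiset.exists_mem_of_ne_zero hS
  obtain ⟨S, rfl⟩ := Multiset.exists_cons_of_mem hi
  rw [Multiset.map_cons, Multiset.prod_cons, mul_coeff_zero, coeff_zero_carlitzE, zero_mul]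

/-- After multiplication by `l_{d-1}`, the values of `Λ_d` at products of the `E_{d-m+i}` are given
by polynomials in `θ^{q^{d-m}}` that do not depend on `d`. -/
theorem exists_eval_eq_harmonicFunctional (m : ℕ) (S : Multiset ℕ) (hS : S ≠ 0) :
    ∃ P : Fq[X][X], ∀ d, m ≤ d →
      algebraMap Fq[X] (RatFunc Fq) (lPoly Fq (d - 1)) *
        harmonicFunctional Fq d (S.map fun i => carlitzE Fq (d - m + i)).prod =
      algebraMap Fq[X] (RatFunc Fq) (P.eval (X ^ Fintype.card Fq ^ (d - m))) := by
  have hq : 1 < Fintype.card Fq := Fintype.one_lt_card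
  induction hn : S.card using Nat.strong_induction_on generalizing S with
  | _ n ih =>
  subst hn
  by_cases hm : ∃ i ∈ S, m ≤ i
  · obtain ⟨i, hi, hmi⟩ := hm
    obtain ⟨S, rfl⟩ := Multiset.exists_cons_of_mem hi
    refine ⟨0, fun d hd => ?_⟩
    rw [Multiset.map_cons, Multiset.prod_cons,
      harmonicFunctional_mul_carlitzE_eq_zero Fq (by omega)]
    simp
  push Not at hm
  by_cases hc : ∃ i, Fintype.card Fq ≤ S.count i
  · obtain ⟨i, hi⟩ := hc
    obtain ⟨S, rfl⟩ := Multiset.le_iff_exists_add.1 (Multiset.le_count_iff_replicate_le.1 hi)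
    obtain ⟨P₁, hP₁⟩ := ih (i ::ₘ S).card (by simp; omega) (i ::ₘ S) (by simp) rfl
    obtain ⟨P₂, hP₂⟩ := ih ((i + 1) ::ₘ S).card (by simp; omega) ((i + 1) ::ₘ S) (by simp) rfl
    -- Replace q copies of E_{d-m+i} by E_{d-m+i} + [d-m+i+1] E_{d-m+i+1}; the bracket equals
    -- Y^{q^{i+1}} - θ. Both new products have q-1 fewer factors.
    refine ⟨P₁ + (X ^ Fintype.card Fq ^ (i + 1) - C X) * P₂, fun d hd => ?_⟩
    have h1 := hP₁ d hd
    have h2 := hP₂ d hd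
    simp only [Multiset.map_cons, Multiset.prod_cons, Multiset.map_add, Multiset.prod_add,
      Multiset.map_replicate, Multiset.prod_replicate, carlitzE_pow, add_mul, map_add, eval_add,
      eval_mul, eval_sub, eval_pow, eval_X, eval_C, map_mul, map_sub, map_pow,
      RatFunc.algebraMap_X, mul_add, ← smul_eq_C_mul, ← add_assoc] at *
    rw [h1, ← h2]
    simp only [bracket, pow_add, pow_mul, smul_mul_assoc, map_smul, smul_eq_mul]
    ring
  · push Not at hc
    by_cases h1 : S.card = 1
    · obtain ⟨i, rfl⟩ := Multiset.card_eq_one.1 h1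
      have hi : i < m := hm i (by simp)
      refine ⟨∏ n ∈ Finset.Ico (i + 1) m, (C X - X ^ Fintype.card Fq ^ n), fun d hd => ?_⟩
      rw [harmonicFunctional_eq_coeff_one Fq (coeff_zero_prod_carlitzE Fq hS _) (by
        have := natDegree_prod_carlitzE_lt Fq hm hc (d - m)
        rwa [Nat.sub_add_cancel hd] at this)]
      rw [Multiset.map_singleton, Multiset.prod_singleton, coeff_one_carlitzE,
        lPoly_pred_eq_mul Fq hd hi, map_mul, mul_right_comm,
        mul_inv_cancel₀ (algebraMap_lPoly_ne_zero Fq _), one_mul, eval_prod]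
      simp
    -- With at least two factors, all without constant term, the product has no linear term.
    · refine ⟨0, fun d hd => ?_⟩
      rw [harmonicFunctional_eq_coeff_one Fq (coeff_zero_prod_carlitzE Fq hS _) (by
        have := natDegree_prod_carlitzE_lt Fq hm hc (d - m)
        rwa [Nat.sub_add_cancel hd] at this)]
      obtain ⟨i, hi⟩ := Multiset.exists_mem_of_ne_zero hS
      obtain ⟨S, rfl⟩ := Multiset.exists_cons_of_mem hi
      have hS' : S ≠ 0 := by rintro rfl; simp at h1
      rw [Multiset.map_cons, Multiset.prod_cons, mul_coeff_one, coeff_zero_carlitzE,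
        coeff_zero_prod_carlitzE Fq hS']
      simp

end Reduction

/-! ### Existence and uniqueness of the universal polynomial -/

section Existence

variable (Fq : Type*) [Field Fq] [Fintype Fq]

theorem mem_monicOfDegree {d : ℕ} {a : Fq[X]} :
    a ∈ monicOfDegree Fq d ↔ a.Monic ∧ a.natDegree = d := by
  simp [monicOfDegree]

/-- Every nonzero polynomial is uniquely a unit of F_q times a monic one, and g does not see the
unit. -/
theorem sum_vecPoly_eq {M : Type*} [AddCommMonoid M] (g : Fq[X] → M) (h0 : g 0 = 0)
    (hg : ∀ (c : Fqˣ) (a : Fq[X]), g ((c : Fq) • a) = g a) (d : ℕ) :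
    ∑ v, g (vecPoly Fq d v) =
      (Fintype.card Fq - 1) • ∑ i ∈ Finset.range d, ∑ a ∈ monicOfDegree Fq i, g a := by
  classical
  have hcard : Fintype.card Fq - 1 = (Finset.univ : Finset Fqˣ).card := by
    rw [Finset.card_univ, Fintype.card_units]
  rw [← Finset.sum_image (f := g) (s := Finset.univ) (g := vecPoly Fq d)
    (vecPoly_injective Fq d).injOn, Finset.sum_sigma', hcard, ← Finset.sum_const,
    ← Finset.sum_product']
  symm
  refine Finset.sum_of_injOn (fun p => (p.1 : Fq) • p.2.2) ?_ ?_ ?_ ?_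
  · rintro ⟨c, i, a⟩ h ⟨c', i', a'⟩ h' heq
    simp only [Finset.coe_product, Set.mem_prod, Finset.mem_coe, Finset.mem_sigma,
      mem_monicOfDegree] at h h' heq
    obtain ⟨-, -, ha, rfl⟩ := h
    obtain ⟨-, -, ha', rfl⟩ := h'
    have hc : c = c' := by
      have := congrArg leadingCoeff heq
      rw [smul_eq_C_mul, smul_eq_C_mul, leadingCoeff_mul, leadingCoeff_mul, ha, ha'] at this
      exact Units.ext (by simpa using this)
    subst hc
    have : a = a' := smul_right_injective _ c.ne_zero heq
    subst this
    rfl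
  · rintro ⟨c, i, a⟩ h
    simp only [Finset.coe_product, Set.mem_prod, Finset.mem_coe, Finset.mem_sigma,
      mem_monicOfDegree] at h
    obtain ⟨-, hi, ha, rfl⟩ := h
    simp only [Finset.coe_image, Finset.coe_univ, Set.image_univ, Set.mem_range]
    refine exists_vecPoly_eq Fq ?_
    refine (degree_smul_le _ _).trans_lt ?_
    rw [degree_eq_natDegree ha.ne_zero]
    exact_mod_cast Finset.mem_range.1 hi
  · intro a ha hna
    obtain ⟨v, -, rfl⟩ := Finset.mem_image.1 ha
    by_contra hne
    set a := vecPoly Fq d v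
    have ha0 : a ≠ 0 := fun h => hne (by rw [h, h0])
    have hl : a.leadingCoeff ≠ 0 := leadingCoeff_ne_zero.2 ha0
    refine hna ⟨(Units.mk0 _ hl, ⟨a.natDegree, a.leadingCoeff⁻¹ • a⟩), ?_, ?_⟩
    · simp only [Finset.coe_product, Set.mem_prod, Finset.mem_coe, Finset.mem_sigma,
        mem_monicOfDegree, Finset.mem_univ, true_and, Finset.mem_range]
      refine ⟨(natDegree_lt_iff_degree_lt ha0).2 (degree_vecPoly_lt Fq d v), ?_, ?_⟩
      · rw [smul_eq_C_mul, mul_comm]; exact monic_mul_leadingCoeff_inv ha0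
      · rw [smul_eq_C_mul, natDegree_C_mul (inv_ne_zero hl)]
    · simp [smul_smul, mul_inv_cancel₀ hl]
  · rintro ⟨c, i, a⟩ -
    exact (hg c a).symm

theorem harmonicSum_one_eq {s m : ℕ} (hs : s = (Fintype.card Fq - 1) * m + 1) (d : ℕ) :
    harmonicSum Fq s d 1 = -∑ v, MvPolynomial.C (vecRat Fq d v)⁻¹ *
      ∏ j : Fin s, aeval (MvPolynomial.X j : MvPolynomial (Fin s) (RatFunc Fq))
        (vecPoly Fq d v) := by
  have h := sum_vecPoly_eq Fq (fun a => MvPolynomial.C (algebraMap Fq[X] (RatFunc Fq) a)⁻¹ *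
      ∏ j : Fin s, aeval (MvPolynomial.X j : MvPolynomial (Fin s) (RatFunc Fq)) a)
    (by simp) (fun c a => by
      have h1 : algebraMap Fq[X] (RatFunc Fq) ((c : Fq) • a) =
          algebraMap Fq (RatFunc Fq) c * algebraMap Fq[X] (RatFunc Fq) a := by
        rw [Algebra.smul_def, map_mul, ← IsScalarTower.algebraMap_apply]
      -- The congruence s ≡ 1 mod q-1 enters here: the numerator scales by c^s = c, which cancels
      -- the scaling of the denominator.
      have hc : (c : Fq) ^ s = c := by
        rw [hs, pow_succ, pow_mul, FiniteField.pow_card_sub_one_eq_one _ c.ne_zero, one_pow,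
          one_mul]
      have h2 : ∏ j : Fin s,
          aeval (MvPolynomial.X j : MvPolynomial (Fin s) (RatFunc Fq)) ((c : Fq) • a) =
          MvPolynomial.C (algebraMap Fq (RatFunc Fq) c) *
          ∏ j : Fin s, aeval (MvPolynomial.X j : MvPolynomial (Fin s) (RatFunc Fq)) a := by
        have h3 : ∀ j : Fin s,
            aeval (MvPolynomial.X j : MvPolynomial (Fin s) (RatFunc Fq)) ((c : Fq) • a) =
            MvPolynomial.C (algebraMap Fq (RatFunc Fq) c) *
              aeval (MvPolynomial.X j : MvPolynomial (Fin s) (RatFunc Fq)) a := fun j => by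
          rw [map_smul, Algebra.smul_def]; rfl
        rw [Finset.prod_congr rfl fun j _ => h3 j, Finset.prod_mul_distrib, Finset.prod_const,
          ← map_pow, ← map_pow, Finset.card_univ, Fintype.card_fin, hc]
      have hc0 : algebraMap Fq (RatFunc Fq) c ≠ 0 := by simp
      have h4 : (MvPolynomial.C (algebraMap Fq (RatFunc Fq) c)⁻¹ *
          MvPolynomial.C (algebraMap Fq (RatFunc Fq) c) : MvPolynomial (Fin s) (RatFunc Fq)) = 1 := by
        rw [← map_mul, inv_mul_cancel₀ hc0, map_one]
      rw [h1, h2, mul_inv, map_mul]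
      linear_combination MvPolynomial.C (algebraMap Fq[X] (RatFunc Fq) a)⁻¹ *
        (∏ j : Fin s, aeval (MvPolynomial.X j : MvPolynomial (Fin s) (RatFunc Fq)) a) * h4) d
  -- The multiplicity q-1 is -1 in characteristic p, whence the sign in the definition of Λ_d.
  have hq : ((Fintype.card Fq - 1 : ℕ) : MvPolynomial (Fin s) (RatFunc Fq)) = -1 := by
    have h3 : ((Fintype.card Fq : ℕ) : Fq) = 0 := FiniteField.cast_card_eq_zero Fq
    have h4 : ((Fintype.card Fq : ℕ) : MvPolynomial (Fin s) (RatFunc Fq)) = 0 := by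
      rw [← map_natCast (algebraMap Fq (MvPolynomial (Fin s) (RatFunc Fq))), h3, map_zero]
    rw [Nat.cast_sub Fintype.card_pos, h4]
    simp
  simp only [nsmul_eq_mul, hq, ← vecRat_apply] at h
  rw [h, harmonicSum, neg_mul, one_mul, neg_neg]
  refine Finset.sum_congr rfl fun i _ => ?_
  rw [powerSum]
  simp only [zpow_neg, zpow_one]

theorem harmonicSum_one_eq_sum {s m : ℕ} (hs : s = (Fintype.card Fq - 1) * m + 1) (d : ℕ) :
    harmonicSum Fq s d 1 = ∑ κ ∈ Fintype.piFinset fun _ : Fin s => Finset.range d,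
      MvPolynomial.C (harmonicFunctional Fq d (∏ j, carlitzE Fq (κ j))) *
      ∏ j : Fin s, aeval (MvPolynomial.X j : MvPolynomial (Fin s) (RatFunc Fq))
        (bPoly Fq (κ j)) := by
  have hexp : ∀ (v : Fin d → Fq) (j : Fin s),
      aeval (MvPolynomial.X j : MvPolynomial (Fin s) (RatFunc Fq)) (vecPoly Fq d v) =
      ∑ k ∈ Finset.range d, MvPolynomial.C (evalE Fq k (vecRat Fq d v)) *
        aeval (MvPolynomial.X j : MvPolynomial (Fin s) (RatFunc Fq)) (bPoly Fq k) := by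
    intro v j
    rw [vecRat_apply]
    refine aeval_eq_sum_evalE Fq _ (fun k => aeval (MvPolynomial.X j) (bPoly Fq k)) ?_ ?_
      (degree_vecPoly_lt Fq d v)
    · simp [bPoly]
    · intro k
      simp only [bPoly_succ, map_mul, map_sub, aeval_X, aeval_C]
      rw [IsScalarTower.algebraMap_apply Fq[X] (RatFunc Fq)]
      simp
  rw [harmonicSum_one_eq Fq hs]
  have h1 : ∀ v : Fin d → Fq, ∏ j : Fin s,
      aeval (MvPolynomial.X j : MvPolynomial (Fin s) (RatFunc Fq)) (vecPoly Fq d v) =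
      ∑ κ ∈ Fintype.piFinset fun _ : Fin s => Finset.range d,
        MvPolynomial.C (∏ j, evalE Fq (κ j) (vecRat Fq d v)) * ∏ j : Fin s,
          aeval (MvPolynomial.X j : MvPolynomial (Fin s) (RatFunc Fq)) (bPoly Fq (κ j)) := by
    intro v
    rw [Finset.prod_congr rfl fun j _ => hexp v j, Finset.prod_univ_sum]
    simp only [Finset.prod_mul_distrib, map_prod]
  simp only [h1, Finset.mul_sum]
  rw [Finset.sum_comm, ← Finset.sum_neg_distrib]
  refine Finset.sum_congr rfl fun κ _ => ?_
  simp only [harmonicFunctional_apply, map_neg, map_sum, neg_mul, Finset.sum_mul, map_mul,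
    eval_prod, ← evalE_apply, mul_assoc]

theorem bPoly_add (K k : ℕ) : bPoly Fq (K + k) =
    bPoly Fq K * ∏ i ∈ Finset.range k, (X - C ((X ^ Fintype.card Fq ^ K) ^ Fintype.card Fq ^ i)) := by
  rw [bPoly, bPoly, Finset.prod_range_add]
  simp only [← pow_mul, ← pow_add]

/-- An index κ with some κ_j < d-m contributes zero, so the remaining indices lie in [d-m, d) and
are recentred to [0, m), a range independent of d. -/
theorem harmonicSum_one_eq_sum_of_le {s m : ℕ} (hs : s = (Fintype.card Fq - 1) * m + 1)
    (hm : 1 ≤ m) {d : ℕ} (hd : m ≤ d) :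
    harmonicSum Fq s d 1 = ∑ κ ∈ Fintype.piFinset fun _ : Fin s => Finset.range m,
      MvPolynomial.C (harmonicFunctional Fq d (∏ j, carlitzE Fq (d - m + κ j))) *
      ∏ j : Fin s, aeval (MvPolynomial.X j : MvPolynomial (Fin s) (RatFunc Fq))
        (bPoly Fq (d - m + κ j)) := by
  have hq : 1 < Fintype.card Fq := Fintype.one_lt_card
  have hs2 : 2 ≤ s := by
    have : 1 * 1 ≤ (Fintype.card Fq - 1) * m := Nat.mul_le_mul (by omega) hm
    omega
  have : Nontrivial (Fin s) := Fin.nontrivial_iff_two_le.2 hs2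
  rw [harmonicSum_one_eq_sum Fq hs]
  symm
  refine Finset.sum_of_injOn (fun κ j => d - m + κ j) ?_ ?_ ?_ ?_
  · intro κ _ κ' _ h
    funext j
    have := congrFun h j
    simpa using this
  · intro κ hκ
    simp only [Finset.mem_coe, Fintype.mem_piFinset, Finset.mem_range] at *
    intro j
    have := hκ j
    omega
  · intro κ hκ hn
    simp only [Fintype.mem_piFinset, Finset.mem_range] at hκ
    by_cases h : ∃ j, κ j + m < d
    · obtain ⟨j, hj⟩ := h
      rw [harmonicFunctional_prod_eq_zero Fq (by simpa using hs) κ j hj]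
      simp
    · push Not at h
      refine absurd ⟨fun j => κ j - (d - m), ?_, ?_⟩ hn
      · simp only [Finset.mem_coe, Fintype.mem_piFinset, Finset.mem_range]
        intro j
        have := hκ j
        have := h j
        omega
      · funext j
        have := h j
        simp only
        omega
  · intro κ _
    rfl

theorem exists_isUniversal {s m : ℕ} (hs : s = (Fintype.card Fq - 1) * m + 1) (hm : 1 ≤ m)
    (hmIdx : mIdx Fq s = m) : ∃ H, IsUniversal Fq s H := by
  have hs0 : NeZero s := ⟨by omega⟩
  have hP : ∀ κ : Fin s → ℕ, ∃ P : Fq[X][X], ∀ d, m ≤ d →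
      algebraMap Fq[X] (RatFunc Fq) (lPoly Fq (d - 1)) *
        harmonicFunctional Fq d (∏ j, carlitzE Fq (d - m + κ j)) =
      algebraMap Fq[X] (RatFunc Fq) (P.eval (X ^ Fintype.card Fq ^ (d - m))) := by
    intro κ
    obtain ⟨P, hP⟩ := exists_eval_eq_harmonicFunctional Fq m (Finset.univ.val.map κ) (by
      rw [ne_eq, Multiset.map_eq_zero, Finset.val_eq_zero]
      exact Finset.univ_nonempty.ne_empty)
    refine ⟨P, fun d hd => ?_⟩
    rw [← hP d hd, Multiset.map_map]
    rfl
  choose P hP using hP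
  -- P κ accounts for l_{d-1} Λ_d, and the inner product is b_{d-m+κ_j}(t_j)/b_{d-m}(t_j) with
  -- θ^{q^{d-m}} replaced by the variable Y.
  refine ⟨∑ κ ∈ Fintype.piFinset fun _ : Fin s => Finset.range (mIdx Fq s),
    (P κ).map MvPolynomial.C *
      ∏ j, ∏ i ∈ Finset.range (κ j), (C (MvPolynomial.X j) - X ^ Fintype.card Fq ^ i),
    fun d _ hd => ?_⟩
  subst hmIdx
  rw [harmonicSum_one_eq_sum_of_le Fq hs hm hd, evalY, eval_finsetSum, map_sum, Finset.mul_sum]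
  refine Finset.sum_congr rfl fun κ _ => ?_
  have h1 : harmonicFunctional Fq d (∏ j, carlitzE Fq (d - mIdx Fq s + κ j)) =
      (algebraMap Fq[X] (RatFunc Fq) (lPoly Fq (d - 1)))⁻¹ *
        algebraMap Fq[X] (RatFunc Fq) ((P κ).eval (X ^ Fintype.card Fq ^ (d - mIdx Fq s))) := by
    rw [← hP κ d hd, inv_mul_cancel_left₀ (algebraMap_lPoly_ne_zero Fq _)]
  rw [h1, PiFactor]
  simp only [bPoly_add, map_mul, Finset.prod_mul_distrib, eval_mul, eval_prod,
    map_prod, eval_sub, eval_pow, eval_C, eval_X, map_sub, map_pow, MvPolynomial.map_C,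
    MvPolynomial.map_X, aeval_X, aeval_C]
  have h2 : eval (MvPolynomial.C X ^ Fintype.card Fq ^ (d - mIdx Fq s)) ((P κ).map MvPolynomial.C) =
      (MvPolynomial.C (eval (X ^ Fintype.card Fq ^ (d - mIdx Fq s)) (P κ)) :
        MvPolynomial (Fin s) Fq[X]) := by
    rw [← map_pow, eval_map, eval₂_hom]
  rw [h2]
  simp only [algebraMap_mvPolynomial_eq_C, MvPolynomial.map_C]
  ring

theorem PiFactor_ne_zero (s d : ℕ) : PiFactor Fq s d ≠ 0 := by
  rw [PiFactor]
  refine mul_ne_zero ?_ (Finset.prod_ne_zero_iff.2 fun j _ => ?_)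
  · rw [ne_eq, MvPolynomial.C_eq_zero]
    exact inv_ne_zero (algebraMap_lPoly_ne_zero Fq _)
  · rw [bPoly, map_prod]
    refine Finset.prod_ne_zero_iff.2 fun k _ => ?_
    rw [map_sub, aeval_X, aeval_C, algebraMap_mvPolynomial_eq_C]
    intro h
    have := congrArg (MvPolynomial.coeff (Finsupp.single j 1)) h
    rw [MvPolynomial.coeff_sub, MvPolynomial.coeff_C, if_neg (by simp [eq_comm])] at this
    simp at this

theorem isUniversal_unique {s : ℕ} {H H' : (MvPolynomial (Fin s) Fq[X])[X]}
    (h : IsUniversal Fq s H) (h' : IsUniversal Fq s H') : H = H' := by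
  -- The shift n + 1 keeps d = n + 1 + m at least 1 whatever m is.
  refine eq_of_infinite_eval_eq H H' (Set.Infinite.mono (s := Set.range fun n : ℕ =>
    (MvPolynomial.C (X ^ Fintype.card Fq ^ (n + 1)) : MvPolynomial (Fin s) Fq[X])) ?_ ?_)
  · rintro _ ⟨n, rfl⟩
    have h1 := h (n + 1 + mIdx Fq s) (by omega) (by omega)
    rw [h' (n + 1 + mIdx Fq s) (by omega) (by omega), Nat.add_sub_cancel] at h1
    exact (MvPolynomial.map_injective _ (IsFractionRing.injective Fq[X] (RatFunc Fq))
      (mul_left_cancel₀ (PiFactor_ne_zero Fq s _) h1)).symm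
  · refine Set.infinite_range_of_injective fun a b hab => ?_
    have h1 := MvPolynomial.C_injective _ _ hab
    have h2 := congrArg natDegree h1
    simp only [natDegree_X_pow] at h2
    have := Nat.pow_right_injective (Fintype.one_lt_card (α := Fq)) h2
    omega

end Existence

/-! ### Ultrametric estimates for products near 1 -/

section Ultrametric

theorem isUnit_of_norm_sub_one_lt_one {R : Type*} [NormedCommRing R] [CompleteSpace R] {x : R}
    (h : ‖x - 1‖ < 1) : IsUnit x := by
  have := isUnit_one_sub_of_norm_lt_one (x := 1 - x) (by rwa [norm_sub_rev])
  rwa [sub_sub_cancel] at this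

variable {R : Type*} [NormedCommRing R] [NormOneClass R] [IsUltrametricDist R]

theorem norm_le_one_of_norm_sub_one_le {x : R} (h : ‖x - 1‖ ≤ 1) : ‖x‖ ≤ 1 := by
  have := IsUltrametricDist.norm_add_le_max (x - 1) 1
  rw [sub_add_cancel, norm_one, max_eq_right h] at this
  exact this

theorem norm_mul_sub_one_le {x y : R} {r : ℝ} (hr1 : r ≤ 1) (hx : ‖x - 1‖ ≤ r)
    (hy : ‖y - 1‖ ≤ r) : ‖x * y - 1‖ ≤ r := by
  rw [show x * y - 1 = (x - 1) * y + (y - 1) by ring]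
  refine (IsUltrametricDist.norm_add_le_max _ _).trans (max_le ?_ hy)
  calc ‖(x - 1) * y‖ ≤ ‖x - 1‖ * ‖y‖ := norm_mul_le _ _
    _ ≤ ‖x - 1‖ * 1 := by
        gcongr
        exact norm_le_one_of_norm_sub_one_le (hy.trans hr1)
    _ ≤ r := by rwa [mul_one]

/-- For r ≤ 1 the ball of radius r about 1 is closed under multiplication, so the bound does not
grow with the number of factors and survives infinite products. -/
theorem norm_prod_sub_one_le {ι : Type*} (t : Finset ι) {f : ι → R} {r : ℝ} (hr0 : 0 ≤ r)
    (hr1 : r ≤ 1) (hf : ∀ i, ‖f i - 1‖ ≤ r) : ‖∏ i ∈ t, f i - 1‖ ≤ r := by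
  classical
  induction t using Finset.induction_on with
  | empty => simpa using hr0
  | insert i t hi ih =>
    rw [Finset.prod_insert hi]
    exact norm_mul_sub_one_le hr1 (hf i) ih

theorem norm_tprod_sub_one_le {ι : Type*} {f : ι → R} {r : ℝ} (hr0 : 0 ≤ r)
    (hr1 : r ≤ 1) (hf : ∀ i, ‖f i - 1‖ ≤ r) (hm : Multipliable f) : ‖∏' i, f i - 1‖ ≤ r := by
  have h := (hm.hasProd.sub_const (1 : R)).norm
  exact le_of_tendsto h (Eventually.of_forall fun t => norm_prod_sub_one_le t hr0 hr1 hf)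

end Ultrametric

/-! ### The Gauss norm is ultrametric -/

section TateNorm

variable (C : Type*) [NormedField C] [IsUltrametricDist C] (s : ℕ)

instance : IsUltrametricDist (GaussPoly C s) :=
  IsUltrametricDist.isUltrametricDist_of_forall_norm_add_le_max_norm fun f g => by
    have h (a b : MvPolynomial (Fin s) C) :
        gaussNNNorm (a + b) ≤ max (gaussNNNorm a) (gaussNNNorm b) := by
      rw [gaussNNNorm_le_iff]
      intro n
      rw [MvPolynomial.coeff_add]
      exact (IsUltrametricDist.nnnorm_add_le_max _ _).trans
        (max_le_max (nnnorm_coeff_le _ _) (nnnorm_coeff_le _ _))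
    exact_mod_cast h f g

instance : IsUltrametricDist (Tate C s) :=
  IsUltrametricDist.isUltrametricDist_of_forall_norm_add_le_max_norm fun x y => by
    refine UniformSpace.Completion.induction_on₂ x y
      (isClosed_le (by fun_prop) (by fun_prop)) fun a b => ?_
    rw [← UniformSpace.Completion.coe_add, UniformSpace.Completion.norm_coe,
      UniformSpace.Completion.norm_coe, UniformSpace.Completion.norm_coe]
    exact IsUltrametricDist.norm_add_le_max a b

theorem polyToTate_injective : Function.Injective (polyToTate C s) :=
  UniformSpace.Completion.coe_injective (GaussPoly C s)

end TateNorm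

/-! ### Tails of the infinite products, embeddings and norms -/

section Norms

variable (Fq : Type*) [Field Fq] [Fintype Fq] (s : ℕ)

theorem norm_tConst (c : CInf Fq) : ‖tConst Fq s c‖ = ‖c‖ := by
  rw [tConst, RingHom.comp_apply, norm_polyToTate, ← coe_nnnorm, NNReal.coe_inj]
  classical
  refine le_antisymm ((gaussNNNorm_le_iff _ _).2 fun n => ?_) ?_
  · rw [MvPolynomial.coeff_C]
    split_ifs <;> simp
  · simpa using nnnorm_coeff_le (MvPolynomial.C c : MvPolynomial (Fin s) (CInf Fq)) 0

variable {s} in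
theorem norm_tVar_le (j : Fin s) : ‖tVar Fq j‖ ≤ 1 := by
  simpa using norm_term_le Fq s 1 j

theorem one_lt_norm_theta : 1 < ‖theta Fq‖ := by
  rw [norm_theta]; exact_mod_cast Fintype.one_lt_card

theorem theta_ne_zero : theta Fq ≠ 0 := norm_pos_iff.1 (one_pos.trans (one_lt_norm_theta Fq))

/-- `∏_{i ≥ k} (1 - t_j / θ^{q^i})`. -/
def omegaTail {s : ℕ} (j : Fin s) (k : ℕ) : Ts Fq s :=
  ∏' i : ℕ, (1 - tConst Fq s (theta Fq ^ Fintype.card Fq ^ (i + k))⁻¹ * tVar Fq j)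

/-- `∏_{i ≥ d} (1 - θ / θ^{q^i})`. -/
def piTail (d : ℕ) : CInf Fq := ∏' i : ℕ, (1 - theta Fq / theta Fq ^ Fintype.card Fq ^ (i + d))

variable {s}

theorem norm_omegaTail_factor_sub_one_le (j : Fin s) {k n : ℕ} (h : k ≤ n) :
    ‖(1 - tConst Fq s (theta Fq ^ Fintype.card Fq ^ n)⁻¹ * tVar Fq j) - 1‖ ≤
      (‖theta Fq‖⁻¹) ^ Fintype.card Fq ^ k := by
  rw [sub_sub_cancel_left, norm_neg]
  refine (norm_term_le Fq s _ j).trans ?_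
  rw [norm_inv, norm_pow, ← inv_pow]
  exact pow_le_pow_of_le_one (by positivity) (inv_le_one_of_one_le₀ (one_lt_norm_theta Fq).le)
    (Nat.pow_le_pow_right Fintype.card_pos h)

/-- The exponent drops by one index because the numerator θ costs one power of |θ|, absorbed by q^d
+ 1 ≤ q^n. -/
theorem norm_piTail_factor_sub_one_le {d n : ℕ} (h : d + 1 ≤ n) :
    ‖(1 - theta Fq / theta Fq ^ Fintype.card Fq ^ n) - 1‖ ≤
      (‖theta Fq‖⁻¹) ^ Fintype.card Fq ^ d := by
  have h1 := one_lt_norm_theta Fq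
  have hq : 1 < Fintype.card Fq := Fintype.one_lt_card
  have h2 : Fintype.card Fq ^ d + 1 ≤ Fintype.card Fq ^ n := by
    have : Fintype.card Fq ^ d < Fintype.card Fq ^ n := Nat.pow_lt_pow_right hq (by omega)
    omega
  rw [sub_sub_cancel_left, norm_neg, norm_div, norm_pow, inv_pow, div_le_iff₀ (by positivity),
    inv_mul_eq_div, le_div_iff₀ (by positivity), ← pow_succ']
  exact pow_le_pow_right₀ h1.le h2

theorem inv_norm_theta_pow_le_one (n : ℕ) : (‖theta Fq‖⁻¹) ^ n ≤ 1 :=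
  pow_le_one₀ (by positivity) (inv_le_one_of_one_le₀ (one_lt_norm_theta Fq).le)

theorem inv_norm_theta_pow_lt_one {n : ℕ} (hn : n ≠ 0) : (‖theta Fq‖⁻¹) ^ n < 1 :=
  pow_lt_one₀ (by positivity) (inv_lt_one_of_one_lt₀ (one_lt_norm_theta Fq)) hn

theorem multipliable_omegaTail (j : Fin s) (k : ℕ) : Multipliable fun i : ℕ =>
    (1 - tConst Fq s (theta Fq ^ Fintype.card Fq ^ (i + k))⁻¹ * tVar Fq j) := by
  simp_rw [sub_eq_add_neg]
  refine multipliable_one_add_of_summable ?_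
  refine Summable.of_nonneg_of_le (fun _ => norm_nonneg _) (fun i => ?_)
    (summable_geometric_of_lt_one (r := ‖theta Fq‖⁻¹) (by positivity)
      (inv_lt_one_of_one_lt₀ (one_lt_norm_theta Fq)))
  have := norm_omegaTail_factor_sub_one_le Fq j (show i ≤ i + k by omega)
  rw [sub_sub_cancel_left] at this
  exact this.trans (pow_le_pow_of_le_one (by positivity)
    (inv_le_one_of_one_le₀ (one_lt_norm_theta Fq).le) (Nat.lt_pow_self Fintype.one_lt_card).le)

theorem prod_mul_omegaTail (j : Fin s) (k M : ℕ) :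
    (∏ i ∈ Finset.range M,
      (1 - tConst Fq s (theta Fq ^ Fintype.card Fq ^ (i + k))⁻¹ * tVar Fq j)) *
      omegaTail Fq j (k + M) = omegaTail Fq j k := by
  have h := (multipliable_omegaTail Fq j (k + M))
  rw [omegaTail, omegaTail]
  simp only [← add_assoc, add_right_comm _ k M] at h ⊢
  exact Multipliable.prod_mul_tprod_nat_mul' (f := fun i =>
    (1 - tConst Fq s (theta Fq ^ Fintype.card Fq ^ (i + k))⁻¹ * tVar Fq j)) h

theorem prod_mul_piTail {d : ℕ} (hd : 1 ≤ d) (M : ℕ) :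
    (∏ i ∈ Finset.range M, (1 - theta Fq / theta Fq ^ Fintype.card Fq ^ (i + d))) *
      piTail Fq (d + M) = piTail Fq d := by
  have h := multipliable_pi Fq (d + M) (by omega)
  rw [piTail, piTail]
  simp only [← add_assoc, add_right_comm _ d M] at h ⊢
  exact Multipliable.prod_mul_tprod_nat_mul' (f := fun i =>
    (1 - theta Fq / theta Fq ^ Fintype.card Fq ^ (i + d))) h

theorem norm_omegaTail_sub_one_le (j : Fin s) (k : ℕ) :
    ‖omegaTail Fq j k - 1‖ ≤ (‖theta Fq‖⁻¹) ^ Fintype.card Fq ^ k :=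
  norm_tprod_sub_one_le (by positivity) (inv_norm_theta_pow_le_one Fq _)
    (fun _ => norm_omegaTail_factor_sub_one_le Fq j (by omega)) (multipliable_omegaTail Fq j k)

theorem norm_piTail_sub_one_le (d : ℕ) :
    ‖piTail Fq (d + 1) - 1‖ ≤ (‖theta Fq‖⁻¹) ^ Fintype.card Fq ^ d :=
  norm_tprod_sub_one_le (by positivity) (inv_norm_theta_pow_le_one Fq _)
    (fun _ => norm_piTail_factor_sub_one_le Fq (by omega)) (multipliable_pi Fq (d + 1) (by omega))

theorem norm_piTail_eq_one {d : ℕ} (hd : 1 ≤ d) : ‖piTail Fq d‖ = 1 := by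
  obtain ⟨d, rfl⟩ := Nat.exists_eq_add_of_le' hd
  have h : ‖piTail Fq (d + 1) - 1‖ < 1 := (norm_piTail_sub_one_le Fq d).trans_lt
    (inv_norm_theta_pow_lt_one Fq (pow_ne_zero _ Fintype.card_ne_zero))
  have := IsUltrametricDist.norm_add_eq_max_of_norm_ne_norm
    (x := piTail Fq (d + 1) - 1) (y := 1) (by rw [norm_one]; exact h.ne)
  rwa [sub_add_cancel, norm_one, max_eq_right h.le] at this

theorem piTail_ne_zero {d : ℕ} (hd : 1 ≤ d) : piTail Fq d ≠ 0 :=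
  norm_pos_iff.1 (by rw [norm_piTail_eq_one Fq hd]; exact one_pos)

theorem isUnit_omegaTail (j : Fin s) (k : ℕ) : IsUnit (omegaTail Fq j k) :=
  isUnit_of_norm_sub_one_lt_one ((norm_omegaTail_sub_one_le Fq j k).trans_lt
    (inv_norm_theta_pow_lt_one Fq (pow_ne_zero _ Fintype.card_ne_zero)))

theorem GammaProd_eq (d : ℕ) : GammaProd Fq s d =
    (∏ j : Fin s, omegaTail Fq j (d - mIdx Fq s)) * tConst Fq s (piTail Fq d)⁻¹ := by
  rw [GammaProd, Multipliable.tprod_finsetProd fun j _ => multipliable_omegaTail Fq j _]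
  rfl

theorem omega_mul_omegaTail (lam : CInf Fq) (j : Fin s) :
    omega Fq lam j * omegaTail Fq j 0 = tConst Fq s lam := by
  have : omega Fq lam j = tConst Fq s lam * Ring.inverse (omegaTail Fq j 0) := rfl
  rw [this, mul_assoc, Ring.inverse_mul_cancel _ (isUnit_omegaTail Fq j 0), mul_one]

theorem piTilde_eq (lam : CInf Fq) : piTilde Fq lam = theta Fq * lam * (piTail Fq 1)⁻¹ := rfl

theorem KtoC_X : KtoC Fq RatFunc.X = theta Fq := rfl

theorem ofKPoly_C (x : RatFunc Fq) : ofKPoly Fq s (MvPolynomial.C x) = tConst Fq s (KtoC Fq x) := by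
  simp [ofKPoly, tConst]

theorem ofKPoly_X (j : Fin s) : ofKPoly Fq s (MvPolynomial.X j) = tVar Fq j := by
  simp [ofKPoly, tVar]

theorem ofAPoly_C_X : ofAPoly Fq s (MvPolynomial.C X) = tConst Fq s (theta Fq) := by
  simp [ofAPoly, ofKPoly_C, KtoC_X]

theorem ofAPoly_X (j : Fin s) : ofAPoly Fq s (MvPolynomial.X j) = tVar Fq j := by
  simp [ofAPoly, ofKPoly_X]

theorem ofAPoly_injective : Function.Injective (ofAPoly Fq s) :=
  ((polyToTate_injective (CInf Fq) s).comp (MvPolynomial.map_injective _ (KtoC Fq).injective)).comp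
    (MvPolynomial.map_injective _ (IsFractionRing.injective Fq[X] (RatFunc Fq)))

/-! ### The size of `F_d(1; s)` -/

/-- A nonzero constant is a root of unity. -/
theorem norm_KtoC_algebraMap_le_one (c : Fq) : ‖KtoC Fq (algebraMap Fq (RatFunc Fq) c)‖ ≤ 1 := by
  rcases eq_or_ne c 0 with rfl | hc
  · simp
  · have h : KtoC Fq (algebraMap Fq (RatFunc Fq) c) ^ (Fintype.card Fq - 1) = 1 := by
      rw [← map_pow, ← map_pow, FiniteField.pow_card_sub_one_eq_one c hc, map_one, map_one]
    have hq : 1 < Fintype.card Fq := Fintype.one_lt_card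
    have h2 := congrArg norm h
    rw [norm_pow, norm_one] at h2
    exact ((pow_eq_one_iff_of_nonneg (norm_nonneg _) (by omega)).1 h2).le

theorem KtoC_algebraMap_eq_sum (a : Fq[X]) : KtoC Fq (algebraMap Fq[X] (RatFunc Fq) a) =
    ∑ i ∈ Finset.range (a.natDegree + 1),
      KtoC Fq (algebraMap Fq (RatFunc Fq) (a.coeff i)) * theta Fq ^ i := by
  conv_lhs => rw [a.as_sum_range_C_mul_X_pow]
  simp [← KtoC_X]

theorem norm_KtoC_of_monic {a : Fq[X]} (ha : a.Monic) :
    ‖KtoC Fq (algebraMap Fq[X] (RatFunc Fq) a)‖ = ‖theta Fq‖ ^ a.natDegree := by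
  have h1 := one_lt_norm_theta Fq
  rw [KtoC_algebraMap_eq_sum, Finset.sum_range_succ, coeff_natDegree, ha, map_one, map_one, one_mul]
  set t := ∑ i ∈ Finset.range a.natDegree,
      KtoC Fq (algebraMap Fq (RatFunc Fq) (a.coeff i)) * theta Fq ^ i with ht
  have hlt : ‖t‖ < ‖theta Fq ^ a.natDegree‖ := by
    rw [norm_pow]
    rcases Nat.eq_zero_or_pos a.natDegree with h0 | h0
    · simp [ht, h0]
    · refine lt_of_le_of_lt (b := ‖theta Fq‖ ^ (a.natDegree - 1)) ?_
        (pow_lt_pow_right₀ h1 (by omega))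
      refine IsUltrametricDist.norm_sum_le_of_forall_le_of_nonneg (by positivity) fun i hi => ?_
      rw [norm_mul, norm_pow, ← one_mul (‖theta Fq‖ ^ (a.natDegree - 1))]
      have hi' := Finset.mem_range.1 hi
      exact mul_le_mul (norm_KtoC_algebraMap_le_one Fq _) (pow_le_pow_right₀ h1.le (by omega))
        (by positivity) zero_le_one
  rw [IsUltrametricDist.norm_add_eq_max_of_norm_ne_norm hlt.ne, max_eq_right hlt.le, norm_pow]

theorem norm_ofKPoly_aeval_le (a : Fq[X]) (j : Fin s) :
    ‖ofKPoly Fq s (aeval (MvPolynomial.X j : MvPolynomial (Fin s) (RatFunc Fq)) a)‖ ≤ 1 := by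
  rw [aeval_eq_sum_range, map_sum]
  refine IsUltrametricDist.norm_sum_le_of_forall_le_of_nonneg zero_le_one fun i _ => ?_
  rw [Algebra.smul_def, IsScalarTower.algebraMap_apply Fq (RatFunc Fq), map_mul, map_pow, ofKPoly_X]
  have : ofKPoly Fq s (algebraMap (RatFunc Fq) (MvPolynomial (Fin s) (RatFunc Fq))
      (algebraMap Fq (RatFunc Fq) (a.coeff i))) =
      tConst Fq s (KtoC Fq (algebraMap Fq (RatFunc Fq) (a.coeff i))) := ofKPoly_C Fq _
  rw [this]
  refine (norm_mul_le _ _).trans ?_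
  rw [norm_tConst]
  exact mul_le_one₀ (norm_KtoC_algebraMap_le_one Fq _) (norm_nonneg _)
    ((norm_pow_le _ _).trans (pow_le_one₀ (norm_nonneg _) (norm_tVar_le Fq j)))

theorem norm_ofKPoly_powerSum_le (i : ℕ) :
    ‖ofKPoly Fq s (powerSum Fq s i 1)‖ ≤ (‖theta Fq‖⁻¹) ^ i := by
  rw [powerSum, map_sum]
  refine IsUltrametricDist.norm_sum_le_of_forall_le_of_nonneg (by positivity) fun a ha => ?_
  obtain ⟨ha, hdeg⟩ := (mem_monicOfDegree Fq).1 ha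
  rw [map_mul, map_prod, ofKPoly_C, zpow_neg, zpow_one, map_inv₀]
  refine (norm_mul_le _ _).trans ?_
  rw [norm_tConst, norm_inv, norm_KtoC_of_monic Fq ha, hdeg, inv_pow]
  refine mul_le_of_le_one_right (by positivity) ?_
  refine (Finset.norm_prod_le _ _).trans ?_
  exact Finset.prod_le_one (fun _ _ => norm_nonneg _) fun j _ => norm_ofKPoly_aeval_le Fq a j

theorem powerSum_zero (n : ℤ) : powerSum Fq s 0 n = 1 := by
  have : monicOfDegree Fq 0 = {1} := by
    ext a
    rw [mem_monicOfDegree, Finset.mem_singleton]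
    exact ⟨fun h => eq_one_of_monic_natDegree_zero h.1 h.2, fun h => by simp [h]⟩
  simp [powerSum, this]

/-- The term a = 1 contributes exactly 1, while the terms of degree i ≥ 1 have norm at most |θ|^{-i}
< 1. -/
theorem norm_ofKPoly_harmonicSum {d : ℕ} (hd : 1 ≤ d) :
    ‖ofKPoly Fq s (harmonicSum Fq s d 1)‖ = 1 := by
  have h1 := one_lt_norm_theta Fq
  obtain ⟨d, rfl⟩ := Nat.exists_eq_add_of_le' hd
  rw [harmonicSum, Finset.sum_range_succ', powerSum_zero, map_add, map_one, map_sum]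
  set t := ∑ i ∈ Finset.range d, ofKPoly Fq s (powerSum Fq s (i + 1) 1)
  have hlt : ‖t‖ < 1 := by
    refine lt_of_le_of_lt (b := ‖theta Fq‖⁻¹) ?_ (inv_lt_one_of_one_lt₀ h1)
    refine IsUltrametricDist.norm_sum_le_of_forall_le_of_nonneg (by positivity) fun i _ => ?_
    refine (norm_ofKPoly_powerSum_le Fq _).trans ?_
    exact pow_le_of_le_one (by positivity) (inv_le_one_of_one_le₀ h1.le) (by omega)
  rw [IsUltrametricDist.norm_add_eq_max_of_norm_ne_norm (by rw [norm_one]; exact hlt.ne), norm_one,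
    max_eq_right hlt.le]

end Norms

/-! ### Coefficients of ∏ (1 - c X^{q^i}) and base q digits -/

section Digits

variable {R : Type*} [CommRing R]

theorem digitCoeff_zero (q : ℕ) (c : R) : digitCoeff q c 0 = 1 := by simp [digitCoeff]

theorem digitCoeff_eq_ite {q : ℕ} (hq : 1 < q) (c : R) (n : ℕ) :
    digitCoeff q c n = if n % q ≤ 1 then (-c) ^ (n % q) * digitCoeff q c (n / q) else 0 := by
  rcases Nat.eq_zero_or_pos n with rfl | hn
  · simp [digitCoeff]
  · unfold digitCoeff
    rw [Nat.digits_def' hq hn]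
    simp only [List.mem_cons, forall_eq_or_imp, List.sum_cons, pow_add]
    by_cases h1 : n % q ≤ 1
    · by_cases h2 : ∀ x ∈ Nat.digits q (n / q), x ≤ 1
      · rw [if_pos ⟨h1, h2⟩, if_pos h1, if_pos h2]
      · rw [if_neg fun h => h2 h.2, if_pos h1, if_neg h2, mul_zero]
    · rw [if_neg fun h => h1 h.1, if_neg h1]

/-- `∏_{i < M} (1 - c X^{q^i})`. -/
def digitPoly (q : ℕ) (c : R) (M : ℕ) : R[X] := ∏ i ∈ Finset.range M, (1 - C c * X ^ q ^ i)

theorem digitPoly_succ (q : ℕ) (c : R) (M : ℕ) :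
    digitPoly q c (M + 1) = expand R q (digitPoly q c M) * (1 - C c * X) := by
  rw [digitPoly, Finset.prod_range_succ', digitPoly, map_prod]
  simp only [map_sub, map_one, map_mul, expand_C, map_pow, expand_X, ← pow_mul, ← pow_succ',
    pow_zero, pow_one]

/-- Induction on M through P_{M+1}(X) = P_M(X^q)(1 - cX), which strips the lowest digit. Factors
with i ≥ M cannot affect coefficients below q^M. -/
theorem coeff_digitPoly {q : ℕ} (hq : 1 < q) (c : R) {M n : ℕ} (h : n < q ^ M) :
    (digitPoly q c M).coeff n = digitCoeff q c n := by
  induction M generalizing n with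
  | zero =>
    obtain rfl : n = 0 := by simpa using h
    simp [digitPoly, digitCoeff_zero]
  | succ M ih =>
    have hdiv : n / q < q ^ M := by
      rw [Nat.div_lt_iff_lt_mul (by omega), ← pow_succ]; exact h
    have hmd := Nat.mod_add_div n q
    have hlt := Nat.mod_lt n (show 0 < q by omega)
    rw [digitPoly_succ, digitCoeff_eq_ite hq, ← ih hdiv, mul_sub, mul_one, mul_left_comm, coeff_sub,
      coeff_C_mul, coeff_expand (by omega)]
    generalize hr : n % q = r at *
    generalize hn' : n / q = n' at *
    have hdvd : q ∣ n ↔ r = 0 := by rw [Nat.dvd_iff_mod_eq_zero, hr]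
    rcases n with _ | n
    · have hr0 : r = 0 := by rw [← hr]; simp
      simp [hr0]
    · rw [coeff_mul_X, coeff_expand (by omega)]
      -- Lowest digit 0 takes the term 1, digit 1 takes -cX, and a larger digit is hit by neither.
      rcases r with _ | _ | r
      · have hnd : ¬ q ∣ n := fun h1 => by
          have h2 : q ∣ 1 := by
            have := Nat.dvd_sub (hdvd.2 rfl) h1
            simpa using this
          have := Nat.le_of_dvd one_pos h2
          omega
        rw [if_pos (hdvd.2 rfl), if_neg hnd]
        simp
      · have hn : n = q * n' := by omega
        rw [if_neg (by rw [hdvd]; omega), if_pos ⟨n', hn⟩, hn, Nat.mul_div_cancel_left _ (by omega)]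
        simp
      · have hnd : ¬ q ∣ n := fun ⟨k, hk⟩ => by
          have h1 : (n + 1) % q = 1 % q := by rw [hk, Nat.mul_add_mod]
          rw [hr, Nat.mod_eq_of_lt hq] at h1
          omega
        rw [if_neg (by rw [hdvd]; omega), if_neg hnd, if_neg (by omega)]
        simp

end Digits

/-! ### The power series h and its truncations -/

section Series

variable (Fq : Type*) [Field Fq] [Fintype Fq] (s : ℕ)

theorem constantCoeff_seriesG : PowerSeries.constantCoeff (seriesG Fq s) = 1 := by
  rw [← PowerSeries.coeff_zero_eq_constantCoeff_apply, seriesG, PowerSeries.coeff_mk]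
  simp [digitCoeff_zero]

theorem seriesH_mul_seriesG : seriesH Fq s * seriesG Fq s = seriesF Fq s := by
  rw [seriesH, mul_assoc, mul_comm _ (seriesG Fq s), PowerSeries.mul_invOfUnit _ _
    (by rw [constantCoeff_seriesG]; rfl), mul_one]

theorem coeff_zero_seriesH : PowerSeries.coeff 0 (seriesH Fq s) = 1 := by
  have h := congrArg PowerSeries.constantCoeff (seriesH_mul_seriesG Fq s)
  rw [map_mul, constantCoeff_seriesG, mul_one] at h
  rw [PowerSeries.coeff_zero_eq_constantCoeff_apply, h, seriesF, map_prod]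
  refine Finset.prod_eq_one fun j _ => ?_
  rw [← PowerSeries.coeff_zero_eq_constantCoeff_apply, PowerSeries.coeff_mk, digitCoeff_zero]

theorem GammaPoly_eq_X_pow_add (r : ℕ) : ∃ p : (MvPolynomial (Fin s) Fq[X])[X],
    p.degree < (muIdx Fq s - r : ℕ) ∧ GammaPoly Fq s r = X ^ (muIdx Fq s - r) + p := by
  refine ⟨∑ k ∈ Finset.range (muIdx Fq s - r),
    C (PowerSeries.coeff (k + 1) (seriesH Fq s)) * X ^ (muIdx Fq s - r - (k + 1)), ?_, ?_⟩
  · refine (degree_sum_le _ _).trans_lt ((Finset.sup_lt_iff (WithBot.bot_lt_coe _)).2 fun k hk => ?_)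
    refine (degree_C_mul_X_pow_le _ _).trans_lt ?_
    have := Finset.mem_range.1 hk
    exact_mod_cast (by omega)
  · rw [GammaPoly, Finset.sum_range_succ', coeff_zero_seriesH, add_comm]
    simp

theorem monic_GammaPoly (r : ℕ) : (GammaPoly Fq s r).Monic := by
  obtain ⟨p, hp, h⟩ := GammaPoly_eq_X_pow_add Fq s r
  rw [h]; exact monic_X_pow_add hp

theorem natDegree_GammaPoly (r : ℕ) : (GammaPoly Fq s r).natDegree = muIdx Fq s - r := by
  obtain ⟨p, hp, h⟩ := GammaPoly_eq_X_pow_add Fq s r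
  rw [h]
  refine natDegree_eq_of_degree_eq_some ?_
  rw [degree_add_eq_left_of_degree_lt (by rwa [degree_X_pow]), degree_X_pow]

/-- The truncation of `h` satisfies the product identity up to a high power of `Y`. -/
theorem exists_trunc_seriesH_mul_eq {N M : ℕ} (hNM : N < Fintype.card Fq ^ M) :
    ∃ Q : (MvPolynomial (Fin s) Fq[X])[X],
      PowerSeries.trunc (N + 1) (seriesH Fq s) *
        expand _ (Fintype.card Fq ^ mIdx Fq s)
          (digitPoly (Fintype.card Fq) (MvPolynomial.C X) M) =
      (∏ j : Fin s, digitPoly (Fintype.card Fq) (MvPolynomial.X j) M) + X ^ (N + 1) * Q := by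
  have hq : 1 < Fintype.card Fq := Fintype.one_lt_card
  -- Modulo Y^{N+1} the truncation of h and the finite products agree with their series, so h ·
  -- `seriesG` = `seriesF` descends. The discrepancy is a polynomial multiple of Y^{N+1}.
  let Φ := Ideal.Quotient.mk (Ideal.span
    {(PowerSeries.X : PowerSeries (MvPolynomial (Fin s) Fq[X])) ^ (N + 1)})
  have hΦ : ∀ φ ψ, Φ φ = Φ ψ ↔ PowerSeries.X ^ (N + 1) ∣ φ - ψ := fun φ ψ => by
    rw [Ideal.Quotient.eq, Ideal.mem_span_singleton]
  have hc : ∀ (φ : PowerSeries (MvPolynomial (Fin s) Fq[X])) (p : (MvPolynomial (Fin s) Fq[X])[X]),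
      (∀ n < N + 1, p.coeff n = PowerSeries.coeff n φ) → Φ (p : PowerSeries _) = Φ φ := by
    intro φ p h
    rw [hΦ, PowerSeries.X_pow_dvd_iff]
    intro n hn
    rw [map_sub, Polynomial.coeff_coe, h n hn, sub_self]
  have hT := hc (seriesH Fq s) (PowerSeries.trunc (N + 1) (seriesH Fq s)) fun n hn => by
    rw [PowerSeries.coeff_trunc, if_pos hn]
  have hG := hc (seriesG Fq s) (expand _ (Fintype.card Fq ^ mIdx Fq s)
      (digitPoly (Fintype.card Fq) (MvPolynomial.C X) M)) fun n hn => by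
    rw [coeff_expand (pow_pos (by omega) _), seriesG, PowerSeries.coeff_mk]
    split_ifs
    · exact coeff_digitPoly hq _ ((Nat.div_le_self _ _).trans_lt (by omega))
    · rfl
  have hF : ∀ j : Fin s, Φ (digitPoly (Fintype.card Fq)
      (MvPolynomial.X j : MvPolynomial (Fin s) Fq[X]) M : PowerSeries _) =
      Φ (PowerSeries.mk (digitCoeff (Fintype.card Fq) (MvPolynomial.X j))) := fun j =>
    hc _ _ fun n hn => by
      rw [PowerSeries.coeff_mk]
      exact coeff_digitPoly hq _ (by omega)
  have hprod : Φ ((∏ j : Fin s, digitPoly (Fintype.card Fq)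
      (MvPolynomial.X j : MvPolynomial (Fin s) Fq[X]) M : (MvPolynomial (Fin s) Fq[X])[X]) :
        PowerSeries _) = Φ (seriesF Fq s) := by
    rw [seriesF, map_prod, ← Finset.prod_congr rfl fun j _ => hF j, ← map_prod]
    congr 1
    exact map_prod (coeToPowerSeries.ringHom (R := MvPolynomial (Fin s) Fq[X]))
      (fun j => digitPoly (Fintype.card Fq) (MvPolynomial.X j) M) Finset.univ
  have key := congrArg Φ (seriesH_mul_seriesG Fq s)
  rw [map_mul, ← hT, ← hG, ← hprod, ← map_mul, ← Polynomial.coe_mul, hΦ, ← Polynomial.coe_sub,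
    PowerSeries.X_pow_dvd_iff] at key
  simp only [Polynomial.coeff_coe] at key
  obtain ⟨Q, hQ⟩ := X_pow_dvd_iff.2 key
  exact ⟨Q, by rw [← hQ]; ring⟩

end Series

/-! ### Γ_d is approximated by truncations of h at Y^{-1} -/

section Expansion

variable (Fq : Type*) [Field Fq] [Fintype Fq] (s : ℕ)

/-- `θ^{-q^{d-m}}` in the Tate algebra. -/
def yInv (d : ℕ) : Ts Fq s := tConst Fq s (theta Fq ^ Fintype.card Fq ^ (d - mIdx Fq s))⁻¹

theorem norm_yInv (d : ℕ) : ‖yInv Fq s d‖ = (‖theta Fq‖⁻¹) ^ Fintype.card Fq ^ (d - mIdx Fq s) := by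
  rw [yInv, norm_tConst, norm_inv, norm_pow, inv_pow]

theorem norm_yInv_le_one (d : ℕ) : ‖yInv Fq s d‖ ≤ 1 := by
  rw [norm_yInv]; exact inv_norm_theta_pow_le_one Fq _

theorem yInv_pow (d n : ℕ) : yInv Fq s d ^ Fintype.card Fq ^ n =
    tConst Fq s (theta Fq ^ Fintype.card Fq ^ (n + (d - mIdx Fq s)))⁻¹ := by
  rw [yInv, ← map_pow, inv_pow, ← pow_mul, ← pow_add, add_comm]

theorem tendsto_yInv : Tendsto (yInv Fq s) atTop (𝓝 0) := by
  rw [tendsto_zero_iff_norm_tendsto_zero]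
  simp only [norm_yInv]
  refine (tendsto_pow_atTop_nhds_zero_of_lt_one (by positivity)
    (inv_lt_one_of_one_lt₀ (one_lt_norm_theta Fq))).comp ?_
  exact (tendsto_pow_atTop_atTop_of_one_lt Fintype.one_lt_card).comp (tendsto_sub_atTop_nat _)

theorem yInv_mul_theta_pow (d : ℕ) :
    yInv Fq s d * tConst Fq s (theta Fq) ^ Fintype.card Fq ^ (d - mIdx Fq s) = 1 := by
  rw [yInv, ← map_pow, ← map_mul, inv_mul_cancel₀ (pow_ne_zero _ (theta_ne_zero Fq)), map_one]

theorem exists_norm_eval₂_le (P : (MvPolynomial (Fin s) Fq[X])[X]) :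
    ∃ B : ℝ, 0 ≤ B ∧ ∀ y : Ts Fq s, ‖y‖ ≤ 1 → ‖P.eval₂ (ofAPoly Fq s) y‖ ≤ B := by
  refine ⟨∑ i ∈ P.support, ‖ofAPoly Fq s (P.coeff i)‖, Finset.sum_nonneg fun _ _ => norm_nonneg _,
    fun y hy => ?_⟩
  rw [eval₂_eq_sum, Polynomial.sum]
  refine (norm_sum_le _ _).trans (Finset.sum_le_sum fun i _ => ?_)
  refine (norm_mul_le _ _).trans ?_
  exact mul_le_of_le_one_right (norm_nonneg _)
    ((norm_pow_le _ _).trans (pow_le_one₀ (norm_nonneg _) hy))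

theorem eval₂_digitPoly_X_mul_omegaTail (d M : ℕ) (j : Fin s) :
    (digitPoly (Fintype.card Fq) (MvPolynomial.X j) M).eval₂ (ofAPoly Fq s) (yInv Fq s d) *
      omegaTail Fq j (d - mIdx Fq s + M) = omegaTail Fq j (d - mIdx Fq s) := by
  rw [← prod_mul_omegaTail Fq j (d - mIdx Fq s) M, ← coe_eval₂RingHom, digitPoly, map_prod]
  congr 1
  refine Finset.prod_congr rfl fun i _ => ?_
  simp only [coe_eval₂RingHom, eval₂_sub, eval₂_one, eval₂_mul, eval₂_pow, eval₂_C, eval₂_X,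
    ofAPoly_X, yInv_pow]
  rw [mul_comm (tVar Fq j)]

theorem eval₂_expand_digitPoly_mul_piTail {d : ℕ} (hd1 : 1 ≤ d) (hd : mIdx Fq s ≤ d) (M : ℕ) :
    (expand _ (Fintype.card Fq ^ mIdx Fq s) (digitPoly (Fintype.card Fq)
        (MvPolynomial.C X) M)).eval₂ (ofAPoly Fq s) (yInv Fq s d) *
      tConst Fq s (piTail Fq (d + M)) = tConst Fq s (piTail Fq d) := by
  rw [← prod_mul_piTail Fq hd1 M, map_mul, ← coe_eval₂RingHom, digitPoly, map_prod, map_prod,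
    map_prod]
  congr 1
  refine Finset.prod_congr rfl fun i _ => ?_
  simp only [map_sub, map_one, map_mul, expand_C, map_pow, expand_X, coe_eval₂RingHom, eval₂_C,
    eval₂_X, ofAPoly_C_X, ← pow_mul, ← pow_add, yInv_pow]
  rw [← map_mul, div_eq_mul_inv, show mIdx Fq s + i + (d - mIdx Fq s) = i + d by omega]

/-- Cut each infinite product after M factors. The finite parts satisfy a polynomial identity modulo
the power N+1 of the variable, and the tails differ from 1 by at most |y|^{N+1}, where y =
θ^{-q^{d-m}}. All bounds for the finite parts are uniform on |y| ≤ 1, so B does not depend on d. -/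
theorem exists_norm_GammaProd_sub_le (hm : 1 ≤ mIdx Fq s) (N : ℕ) : ∃ B : ℝ, ∀ d, mIdx Fq s ≤ d →
    ‖GammaProd Fq s d -
      (PowerSeries.trunc (N + 1) (seriesH Fq s)).eval₂ (ofAPoly Fq s) (yInv Fq s d)‖ ≤
      B * ‖yInv Fq s d‖ ^ (N + 1) := by
  have hq : 1 < Fintype.card Fq := Fintype.one_lt_card
  have hNM : N + 1 < Fintype.card Fq ^ (N + 1) := Nat.lt_pow_self hq
  -- This M satisfies q^M > N + 1, so the tails, within |y|^{q^M} of 1, are negligible to order N+1.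
  set M := N + 1
  obtain ⟨Q, hQ⟩ := exists_trunc_seriesH_mul_eq Fq s (show N < Fintype.card Fq ^ M by omega)
  set T := PowerSeries.trunc (N + 1) (seriesH Fq s)
  set G := expand _ (Fintype.card Fq ^ mIdx Fq s) (digitPoly (Fintype.card Fq)
        (MvPolynomial.C X : MvPolynomial (Fin s) Fq[X]) M) with hG
  set F := ∏ j : Fin s, digitPoly (Fintype.card Fq) (MvPolynomial.X j : MvPolynomial (Fin s) Fq[X]) M
    with hF
  obtain ⟨BQ, hBQ0, hBQ⟩ := exists_norm_eval₂_le Fq s Q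
  obtain ⟨BF, hBF0, hBF⟩ := exists_norm_eval₂_le Fq s F
  obtain ⟨BT, hBT0, hBT⟩ := exists_norm_eval₂_le Fq s (T * G)
  refine ⟨BF + BT + BQ, fun d hd => ?_⟩
  have hy := norm_yInv_le_one Fq s d
  set y := yInv Fq s d
  set ρ := ‖y‖ ^ (N + 1) with hρ
  have hρ0 : 0 ≤ ρ := by positivity
  set v := piTail Fq d with hv
  set v' := piTail Fq (d + M) with hv'
  set W := ∏ j : Fin s, omegaTail Fq j (d - mIdx Fq s + M)
  have hpow : (‖theta Fq‖⁻¹) ^ Fintype.card Fq ^ (d - mIdx Fq s + M) ≤ ρ := by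
    rw [hρ, norm_yInv, ← pow_mul, pow_add]
    exact pow_le_pow_of_le_one (by positivity) (inv_le_one_of_one_le₀ (one_lt_norm_theta Fq).le)
      (Nat.mul_le_mul_left _ hNM.le)
  have hv1 : ‖tConst Fq s v' - 1‖ ≤ ρ := by
    rw [← map_one (tConst Fq s), ← map_sub, norm_tConst, hv',
      show d + M = d + N + 1 from rfl]
    -- The index lost in the tail bound is recovered from m ≥ 1, since d - m + M ≤ d + N.
    refine (norm_piTail_sub_one_le Fq _).trans (le_trans ?_ hpow)
    exact pow_le_pow_of_le_one (by positivity) (inv_le_one_of_one_le₀ (one_lt_norm_theta Fq).le)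
      (Nat.pow_le_pow_right (by omega) (by omega))
  have hW1 : ‖W - 1‖ ≤ ρ :=
    (norm_prod_sub_one_le _ (by positivity) (inv_norm_theta_pow_le_one Fq _)
      fun j => norm_omegaTail_sub_one_le Fq j _).trans hpow
  have e1 : GammaProd Fq s d = F.eval₂ (ofAPoly Fq s) y * W * tConst Fq s v⁻¹ := by
    rw [GammaProd_eq, hF, ← coe_eval₂RingHom, map_prod, ← Finset.prod_mul_distrib,
      coe_eval₂RingHom]
    simp only [y, eval₂_digitPoly_X_mul_omegaTail]
    rfl
  have e2 : G.eval₂ (ofAPoly Fq s) y * tConst Fq s v' = tConst Fq s v :=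
    eval₂_expand_digitPoly_mul_piTail Fq s (by omega) hd M
  have e3 : tConst Fq s v * tConst Fq s v⁻¹ = 1 := by
    rw [← map_mul, mul_inv_cancel₀ (piTail_ne_zero Fq (by omega)), map_one]
  have e4 := congrArg (eval₂RingHom (ofAPoly Fq s) y) hQ
  simp only [map_mul, map_add, map_pow, coe_eval₂RingHom, eval₂_X] at e4
  have e5 : GammaProd Fq s d - T.eval₂ (ofAPoly Fq s) y = (F.eval₂ (ofAPoly Fq s) y * (W - 1) -
      (T * G).eval₂ (ofAPoly Fq s) y * (tConst Fq s v' - 1) - y ^ (N + 1) *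
        Q.eval₂ (ofAPoly Fq s) y) * tConst Fq s v⁻¹ := by
    rw [e1, eval₂_mul]
    linear_combination (T.eval₂ (ofAPoly Fq s) y * tConst Fq s v⁻¹) * e2 +
      T.eval₂ (ofAPoly Fq s) y * e3 - tConst Fq s v⁻¹ * e4
  rw [e5]
  refine (norm_mul_le _ _).trans ?_
  rw [norm_tConst, norm_inv, norm_piTail_eq_one Fq (by omega), inv_one, mul_one]
  refine (norm_sub_le _ _).trans ?_
  rw [add_mul]
  refine add_le_add ((norm_sub_le _ _).trans ?_) ?_
  · rw [add_mul]
    exact add_le_add ((norm_mul_le _ _).trans (mul_le_mul (hBF y hy) hW1 (norm_nonneg _) hBF0))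
      ((norm_mul_le _ _).trans (mul_le_mul (hBT y hy) hv1 (norm_nonneg _) hBT0))
  · rw [mul_comm BQ]
    exact (norm_mul_le _ _).trans (mul_le_mul (norm_pow_le _ _) (hBQ y hy) (norm_nonneg _) hρ0)

theorem ofAPoly_evalY (P : (MvPolynomial (Fin s) Fq[X])[X]) (k : ℕ) :
    ofAPoly Fq s (evalY Fq P k) =
      P.eval₂ (ofAPoly Fq s) (tConst Fq s (theta Fq) ^ Fintype.card Fq ^ k) := by
  rw [evalY, ← eval₂_hom, map_pow, map_pow, ofAPoly_C_X]

end Expansion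

/-! ### The product formula linking ω, π̃, Π_{s,d} and Γ_d -/

section Period

variable (Fq : Type*) [Field Fq] [Fintype Fq]

theorem neg_one_pow_card_pow {R : Type*} [Ring R] (f : Fq →+* R) (i : ℕ) :
    (-1 : R) ^ Fintype.card Fq ^ i = -1 := by
  have h : (-1 : Fq) ^ Fintype.card Fq ^ i = -1 := FiniteField.pow_card_pow i _
  simpa using congrArg f h

theorem sub_one_mul_geomSum_add_one (n : ℕ) :
    (Fintype.card Fq - 1) * ∑ i ∈ Finset.range n, Fintype.card Fq ^ i + 1 =
      Fintype.card Fq ^ n := by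
  have hq : 1 < Fintype.card Fq := Fintype.one_lt_card
  obtain ⟨p, hp⟩ : ∃ p, Fintype.card Fq = p + 1 := ⟨Fintype.card Fq - 1, by omega⟩
  rw [hp, Nat.add_sub_cancel, mul_comm, geom_sum_mul_add]

theorem muIdx_add_mIdx (s : ℕ) :
    muIdx Fq s + mIdx Fq s = ∑ i ∈ Finset.range (mIdx Fq s), Fintype.card Fq ^ i := by
  rw [muIdx, Nat.geomSum_eq Fintype.one_lt_card]
  refine Nat.sub_add_cancel ?_
  rw [← Nat.geomSum_eq Fintype.one_lt_card]
  calc mIdx Fq s = ∑ i ∈ Finset.range (mIdx Fq s), 1 := by simp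
    _ ≤ _ := Finset.sum_le_sum fun i _ => Nat.one_le_pow _ _ Fintype.card_pos

/-- The map f transports the characteristic: (-1)^{q^i} = -1 in F_q, hence in R, so -x^{q^i} =
(-x)^{q^i}. -/
theorem prod_neg_pow_card_pow {R : Type*} [CommRing R] (f : Fq →+* R) (x : R) (n : ℕ) :
    ∏ i ∈ Finset.range n, -x ^ Fintype.card Fq ^ i =
      (-x) ^ ∑ i ∈ Finset.range n, Fintype.card Fq ^ i := by
  rw [← Finset.prod_pow_eq_pow_sum]
  refine Finset.prod_congr rfl fun i _ => ?_
  rw [neg_eq_neg_one_mul x, mul_pow, neg_one_pow_card_pow Fq f, neg_one_mul]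

theorem neg_one_pow_muIdx {R : Type*} [CommRing R] (f : Fq →+* R) (s : ℕ) :
    (-1 : R) ^ muIdx Fq s = 1 := by
  have h1 : (-1 : R) ^ (muIdx Fq s + mIdx Fq s) = (-1) ^ mIdx Fq s := by
    rw [muIdx_add_mIdx, ← prod_neg_pow_card_pow Fq f]
    simp
  rw [pow_add] at h1
  calc (-1 : R) ^ muIdx Fq s
      = (-1) ^ muIdx Fq s * (-1) ^ mIdx Fq s * (-1) ^ mIdx Fq s := by
        rw [mul_assoc, ← mul_pow]; simp
    _ = 1 := by rw [h1, ← mul_pow]; simp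

/-- Both sides are lam times a power of -x. With g = (q^K - 1)/(q-1), the exponents are m + gs + μ
q^K and g + q^K (μ + m). They agree because s = (q-1)m + 1 gives gs = g + (q^K - 1)m. The sign of
x^{μ q^K} is harmless as (-1)^μ = 1 in R. -/
theorem period_exponent_identity {R : Type*} [CommRing R] (f : Fq →+* R) {s : ℕ}
    (hs : s = (Fintype.card Fq - 1) * mIdx Fq s + 1) {x lam : R}
    (hlam : lam ^ (Fintype.card Fq - 1) = -x) (K : ℕ) :
    (lam * ∏ i ∈ Finset.range K, -x ^ Fintype.card Fq ^ i) ^ s *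
        x ^ (muIdx Fq s * Fintype.card Fq ^ K) =
      lam * ∏ i ∈ Finset.range (K + mIdx Fq s), -x ^ Fintype.card Fq ^ i := by
  have hlam' : lam ^ s = lam * (-x) ^ mIdx Fq s := by
    conv_lhs => rw [hs, pow_succ', pow_mul, hlam]
  have hx : x ^ (muIdx Fq s * Fintype.card Fq ^ K) = (-x) ^ (muIdx Fq s * Fintype.card Fq ^ K) := by
    rw [neg_eq_neg_one_mul x, mul_pow, pow_mul (-1 : R), neg_one_pow_muIdx Fq f, one_pow, one_mul]
  have hK := sub_one_mul_geomSum_add_one Fq K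
  have hm := muIdx_add_mIdx Fq s
  rw [prod_neg_pow_card_pow Fq f, prod_neg_pow_card_pow Fq f, mul_pow, hlam', hx, mul_assoc,
    mul_assoc, ← pow_mul, ← pow_add, ← pow_add, Finset.sum_range_add]
  congr 2
  simp only [pow_add, ← Finset.mul_sum]
  rw [← hm]
  generalize ∑ i ∈ Finset.range K, Fintype.card Fq ^ i = g at *
  generalize Fintype.card Fq ^ K = Q at *
  subst hK
  generalize mIdx Fq s = m at *
  generalize muIdx Fq s = μ at *
  generalize Fintype.card Fq - 1 = p at *
  rw [hs]
  ring

variable {s : ℕ}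

theorem KtoC_lPoly (n : ℕ) : KtoC Fq (algebraMap Fq[X] (RatFunc Fq) (lPoly Fq n)) =
    (∏ i ∈ Finset.range n, -theta Fq ^ Fintype.card Fq ^ (i + 1)) *
      ∏ i ∈ Finset.range n, (1 - theta Fq / theta Fq ^ Fintype.card Fq ^ (i + 1)) := by
  rw [← Finset.prod_mul_distrib]
  induction n with
  | zero => simp [lPoly_zero]
  | succ n ih =>
    rw [lPoly_succ, map_mul, map_mul, ih, Finset.prod_range_succ]
    congr 1
    have := pow_ne_zero (Fintype.card Fq ^ (n + 1)) (theta_ne_zero Fq)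
    simp only [map_sub, map_pow, RatFunc.algebraMap_X, KtoC_X]
    rw [mul_sub, mul_one, neg_mul, mul_div_cancel₀ _ this]
    ring

/-- The factors 1 - θ/θ^{q^i} of l_{d-1} and of the tail recombine into the product inside π̃ and
cancel it. The outer sign appears because π̃ carries θ whereas the factor i = 0 is -θ. -/
theorem piTilde_mul_lPoly_mul_piTail {d : ℕ} (hd : 1 ≤ d) (lam : CInf Fq) :
    piTilde Fq lam * KtoC Fq (algebraMap Fq[X] (RatFunc Fq) (lPoly Fq (d - 1))) * piTail Fq d =
      -(lam * ∏ i ∈ Finset.range d, -theta Fq ^ Fintype.card Fq ^ i) := by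
  obtain ⟨n, rfl⟩ := Nat.exists_eq_add_of_le' hd
  have h1 := prod_mul_piTail Fq le_rfl n
  have h2 := piTail_ne_zero Fq le_rfl
  rw [add_comm 1 n] at h1
  rw [piTilde_eq, KtoC_lPoly, Nat.add_sub_cancel, Finset.prod_range_succ', pow_zero, pow_one]
  calc _ = theta Fq * lam * (∏ i ∈ Finset.range n, -theta Fq ^ Fintype.card Fq ^ (i + 1)) *
        ((piTail Fq 1)⁻¹ * ((∏ i ∈ Finset.range n,
          (1 - theta Fq / theta Fq ^ Fintype.card Fq ^ (i + 1))) * piTail Fq (n + 1))) := by ring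
    _ = _ := by rw [h1, inv_mul_cancel₀ h2]; ring

/-- Each t - θ^{q^i} is -θ^{q^i}(1 - t/θ^{q^i}), so b_K supplies the missing first K factors of the
product. -/
theorem ofKPoly_aeval_bPoly_mul_omegaTail (j : Fin s) (K : ℕ) :
    ofKPoly Fq s (aeval (MvPolynomial.X j : MvPolynomial (Fin s) (RatFunc Fq)) (bPoly Fq K)) *
      omegaTail Fq j K =
    tConst Fq s (∏ i ∈ Finset.range K, -theta Fq ^ Fintype.card Fq ^ i) * omegaTail Fq j 0 := by
  have h := prod_mul_omegaTail Fq j 0 K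
  rw [zero_add] at h
  rw [← h, ← mul_assoc, map_prod, ← Finset.prod_mul_distrib, bPoly, map_prod, map_prod]
  congr 1
  refine Finset.prod_congr rfl fun i _ => ?_
  have h0 : tConst Fq s (theta Fq ^ Fintype.card Fq ^ i) *
      tConst Fq s (theta Fq ^ Fintype.card Fq ^ i)⁻¹ = 1 := by
    rw [← map_mul, mul_inv_cancel₀ (pow_ne_zero _ (theta_ne_zero Fq)), map_one]
  rw [map_sub, aeval_X, aeval_C, algebraMap_mvPolynomial_eq_C, map_sub, ofKPoly_X, ofKPoly_C,
    map_pow, map_pow, RatFunc.algebraMap_X, KtoC_X, add_zero, map_neg]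
  linear_combination -(tVar Fq j) * h0

/-- The product `Π_{s,d} ω(t_1) ⋯ ω(t_s) / π̃` equals `-θ^{-μ q^{d-m}} / Γ_d`. -/
theorem omega_mul_PiFactor_mul_GammaProd (hs : s = (Fintype.card Fq - 1) * mIdx Fq s + 1)
    {lam : CInf Fq} (hlam : lam ^ (Fintype.card Fq - 1) = -theta Fq) {d : ℕ} (hd1 : 1 ≤ d)
    (hd : mIdx Fq s ≤ d) :
    (∏ j : Fin s, omega Fq lam j) * tConst Fq s (piTilde Fq lam)⁻¹ *
      ofKPoly Fq s (PiFactor Fq s d) * GammaProd Fq s d *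
      tConst Fq s (theta Fq) ^ (muIdx Fq s * Fintype.card Fq ^ (d - mIdx Fq s)) = -1 := by
  set K := d - mIdx Fq s with hK
  have hq : 1 < Fintype.card Fq := Fintype.one_lt_card
  have hθ := theta_ne_zero Fq
  have hlam0 : lam ≠ 0 := by
    rintro rfl
    rw [zero_pow (by omega)] at hlam
    exact neg_ne_zero.2 hθ hlam.symm
  have h1 : ∀ j : Fin s, omega Fq lam j *
      ofKPoly Fq s (aeval (MvPolynomial.X j : MvPolynomial (Fin s) (RatFunc Fq)) (bPoly Fq K)) *
        omegaTail Fq j K =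
      tConst Fq s (lam * ∏ i ∈ Finset.range K, -theta Fq ^ Fintype.card Fq ^ i) := fun j => by
    rw [mul_assoc, ofKPoly_aeval_bPoly_mul_omegaTail, mul_left_comm, omega_mul_omegaTail, map_mul,
      mul_comm]
  have h2 : (∏ j : Fin s, omega Fq lam j) *
      (∏ j : Fin s, ofKPoly Fq s (aeval
        (MvPolynomial.X j : MvPolynomial (Fin s) (RatFunc Fq)) (bPoly Fq K))) *
      (∏ j : Fin s, omegaTail Fq j K) =
      tConst Fq s ((lam * ∏ i ∈ Finset.range K, -theta Fq ^ Fintype.card Fq ^ i) ^ s) := by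
    rw [← Finset.prod_mul_distrib, ← Finset.prod_mul_distrib, Finset.prod_congr rfl fun j _ => h1 j]
    simp
  have h3 := piTilde_mul_lPoly_mul_piTail Fq hd1 lam
  have h4 := period_exponent_identity Fq ((KtoC Fq).comp (algebraMap Fq (RatFunc Fq))) hs hlam K
  rw [show K + mIdx Fq s = d by omega] at h4
  set P := ∏ i ∈ Finset.range d, -theta Fq ^ Fintype.card Fq ^ i
  have hP : P ≠ 0 := Finset.prod_ne_zero_iff.2 fun i _ => neg_ne_zero.2 (pow_ne_zero _ hθ)
  rw [PiFactor, ← hK, GammaProd_eq, ← hK, map_mul, map_prod, ofKPoly_C, map_inv₀ (KtoC Fq)]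
  calc _ = ((∏ j : Fin s, omega Fq lam j) *
      (∏ j : Fin s, ofKPoly Fq s (aeval
        (MvPolynomial.X j : MvPolynomial (Fin s) (RatFunc Fq)) (bPoly Fq K))) *
      (∏ j : Fin s, omegaTail Fq j K)) * (tConst Fq s (piTilde Fq lam)⁻¹ *
        tConst Fq s (KtoC Fq (algebraMap Fq[X] (RatFunc Fq) (lPoly Fq (d - 1))))⁻¹ *
        tConst Fq s (piTail Fq d)⁻¹) *
        tConst Fq s (theta Fq) ^ (muIdx Fq s * Fintype.card Fq ^ K) := by ring
    _ = tConst Fq s (((lam * ∏ i ∈ Finset.range K, -theta Fq ^ Fintype.card Fq ^ i) ^ s *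
        theta Fq ^ (muIdx Fq s * Fintype.card Fq ^ K)) * (piTilde Fq lam *
          KtoC Fq (algebraMap Fq[X] (RatFunc Fq) (lPoly Fq (d - 1))) * piTail Fq d)⁻¹) := by
        rw [h2]
        simp only [mul_inv, map_mul, map_pow]
        ring
    _ = -1 := by
        rw [h4, h3, inv_neg, mul_neg, mul_inv_cancel₀ (mul_ne_zero hlam0 hP), map_neg, map_one]

end Period

/-! ### Limits, the degree of H and its coefficients -/

section Limits

variable (Fq : Type*) [Field Fq] [Fintype Fq] {s : ℕ}

theorem yInv_pow_mul_theta_pow (d a b : ℕ) (hab : a ≤ b) :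
    yInv Fq s d ^ a * tConst Fq s (theta Fq) ^ (b * Fintype.card Fq ^ (d - mIdx Fq s)) =
      tConst Fq s (theta Fq) ^ ((b - a) * Fintype.card Fq ^ (d - mIdx Fq s)) := by
  obtain ⟨c, rfl⟩ := Nat.exists_eq_add_of_le hab
  rw [Nat.add_sub_cancel_left, add_mul, pow_add, ← mul_assoc, mul_comm a,
    pow_mul _ _ a, ← mul_pow, yInv_mul_theta_pow, one_pow, one_mul]

theorem ofAPoly_evalY_GammaPoly (r d : ℕ) :
    ofAPoly Fq s (evalY Fq (GammaPoly Fq s r) (d - mIdx Fq s)) =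
      tConst Fq s (theta Fq) ^ ((muIdx Fq s - r) * Fintype.card Fq ^ (d - mIdx Fq s)) *
      (PowerSeries.trunc (muIdx Fq s - r + 1) (seriesH Fq s)).eval₂ (ofAPoly Fq s)
        (yInv Fq s d) := by
  rw [ofAPoly_evalY, GammaPoly, PowerSeries.eval₂_trunc_eq_sum_range, eval₂_finsetSum,
    Finset.mul_sum]
  refine Finset.sum_congr rfl fun k hk => ?_
  have hk' : k ≤ muIdx Fq s - r := by
    have := Finset.mem_range.1 hk
    omega
  rw [eval₂_mul, eval₂_C, eval₂_pow, eval₂_X, ← pow_mul,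
    mul_comm (Fintype.card Fq ^ _), ← yInv_pow_mul_theta_pow Fq d k _ hk']
  ring

/-- Truncating h after order μ-r leaves an error O(|Y|^{-(μ-r)-1}), which the factor Y^{μ-r} turns
into O(1/|Y|). -/
theorem tendsto_theta_pow_mul_GammaProd_sub (hm : 1 ≤ mIdx Fq s) (r : ℕ) :
    Tendsto (fun d : ℕ => tConst Fq s (theta Fq) ^
        ((muIdx Fq s - r) * Fintype.card Fq ^ (d - mIdx Fq s)) * GammaProd Fq s d
      - ofAPoly Fq s (evalY Fq (GammaPoly Fq s r) (d - mIdx Fq s))) atTop (𝓝 0) := by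
  set N := muIdx Fq s - r with hN
  obtain ⟨B, hB⟩ := exists_norm_GammaProd_sub_le Fq s hm N
  have hlim : Tendsto (fun d => B * ‖yInv Fq s d‖) atTop (𝓝 0) := by
    simpa using (tendsto_yInv Fq s).norm.const_mul B
  refine squeeze_zero_norm' ?_ hlim
  filter_upwards [eventually_ge_atTop (mIdx Fq s)] with d hd
  have h1 := hB d hd
  rw [ofAPoly_evalY_GammaPoly, ← hN, ← mul_sub]
  refine (norm_mul_le _ _).trans ?_
  have hθ : ‖tConst Fq s (theta Fq) ^ (N * Fintype.card Fq ^ (d - mIdx Fq s))‖ *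
      ‖yInv Fq s d‖ ^ N = 1 := by
    rw [← map_pow, norm_tConst, norm_yInv, norm_pow, mul_comm N, pow_mul, ← mul_pow, inv_pow,
      mul_inv_cancel₀ (pow_ne_zero _ (norm_ne_zero_iff.2 (theta_ne_zero Fq))), one_pow]
  calc _ ≤ ‖tConst Fq s (theta Fq) ^ (N * Fintype.card Fq ^ (d - mIdx Fq s))‖ *
        (B * ‖yInv Fq s d‖ ^ (N + 1)) := by gcongr
    _ = (‖tConst Fq s (theta Fq) ^ (N * Fintype.card Fq ^ (d - mIdx Fq s))‖ *
        ‖yInv Fq s d‖ ^ N) * (B * ‖yInv Fq s d‖) := by ring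
    _ = B * ‖yInv Fq s d‖ := by rw [hθ, one_mul]

theorem tendsto_GammaProd (hm : 1 ≤ mIdx Fq s) : Tendsto (GammaProd Fq s) atTop (𝓝 1) := by
  have h := tendsto_theta_pow_mul_GammaProd_sub Fq hm (muIdx Fq s)
  have h1 : GammaPoly Fq s (muIdx Fq s) = 1 := by
    simp [GammaPoly, coeff_zero_seriesH]
  simp only [Nat.sub_self, zero_mul, pow_zero, one_mul, h1, evalY, eval_one, map_one] at h
  simpa using h.add_const 1

/-- In Y^{-r} H(Y) the sum cancels all positive powers of Y, and the negative ones tend to zero. -/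
theorem tendsto_yInv_pow_mul_eval_sub (H : (MvPolynomial (Fin s) Fq[X])[X]) {n r : ℕ}
    (hH : H.natDegree ≤ n) (hr : r ≤ n) :
    Tendsto (fun d : ℕ => yInv Fq s d ^ r * ofAPoly Fq s (evalY Fq H (d - mIdx Fq s)) -
      ∑ i ∈ Finset.Icc 1 (n - r), ofAPoly Fq s (H.coeff (i + r)) *
        tConst Fq s (theta Fq) ^ (i * Fintype.card Fq ^ (d - mIdx Fq s)))
      atTop (𝓝 (ofAPoly Fq s (H.coeff r))) := by
  have h : ∀ d : ℕ, yInv Fq s d ^ r * ofAPoly Fq s (evalY Fq H (d - mIdx Fq s)) -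
      ∑ i ∈ Finset.Icc 1 (n - r), ofAPoly Fq s (H.coeff (i + r)) *
        tConst Fq s (theta Fq) ^ (i * Fintype.card Fq ^ (d - mIdx Fq s)) =
      (∑ i ∈ Finset.range r, ofAPoly Fq s (H.coeff i) * yInv Fq s d ^ (r - i)) +
        ofAPoly Fq s (H.coeff r) := by
    intro d
    set Y := tConst Fq s (theta Fq) ^ Fintype.card Fq ^ (d - mIdx Fq s) with hY
    have hyY : yInv Fq s d * Y = 1 := yInv_mul_theta_pow Fq s d
    rw [ofAPoly_evalY, ← hY, eval₂_eq_sum_range' _ (show H.natDegree < r + (n - r + 1) by omega),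
      Finset.sum_range_add, mul_add, Finset.sum_range_succ', Finset.mul_sum]
    have h1 : ∀ i ∈ Finset.range r, yInv Fq s d ^ r * (ofAPoly Fq s (H.coeff i) * Y ^ i) =
        ofAPoly Fq s (H.coeff i) * yInv Fq s d ^ (r - i) := fun i hi => by
      obtain ⟨c, rfl⟩ := Nat.exists_eq_add_of_le (Finset.mem_range.1 hi).le
      rw [Nat.add_sub_cancel_left, pow_add, mul_left_comm, mul_right_comm, ← mul_pow, hyY]
      simp
    have h2 : yInv Fq s d ^ r * Y ^ r = 1 := by rw [← mul_pow, hyY, one_pow]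
    have h3 : ∑ i ∈ Finset.Icc 1 (n - r), ofAPoly Fq s (H.coeff (i + r)) *
        tConst Fq s (theta Fq) ^ (i * Fintype.card Fq ^ (d - mIdx Fq s)) =
        yInv Fq s d ^ r * ∑ i ∈ Finset.range (n - r),
          ofAPoly Fq s (H.coeff (r + (i + 1))) * Y ^ (r + (i + 1)) := by
      have h4 := Finset.sum_Ico_add' (fun i => ofAPoly Fq s (H.coeff (i + r)) *
        tConst Fq s (theta Fq) ^ (i * Fintype.card Fq ^ (d - mIdx Fq s))) 0 (n - r) 1
      rw [Finset.mul_sum, Finset.range_eq_Ico]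
      refine h4.symm.trans (Finset.sum_congr rfl fun i _ => ?_)
      rw [add_comm (i + 1) r, pow_add, mul_comm (i + 1), pow_mul, ← hY]
      linear_combination (-ofAPoly Fq s (H.coeff (r + (i + 1))) * Y ^ (i + 1)) * h2
    rw [Finset.sum_congr rfl h1, h3, add_zero]
    linear_combination ofAPoly Fq s (H.coeff r) * h2
  simp only [h]
  have h0 : Tendsto (fun d => ∑ i ∈ Finset.range r,
      ofAPoly Fq s (H.coeff i) * yInv Fq s d ^ (r - i)) atTop
      (𝓝 (∑ i ∈ Finset.range r, ofAPoly Fq s (H.coeff i) * 0)) := by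
    refine tendsto_finsetSum _ fun i hi => ?_
    have : r - i ≠ 0 := by have := Finset.mem_range.1 hi; omega
    simpa [this] using (((tendsto_yInv Fq s).pow (r - i)).const_mul (ofAPoly Fq s (H.coeff i)))
  simpa using h0.add_const (ofAPoly Fq s (H.coeff r))

theorem omega_mul_harmonicSum_mul_GammaProd (hs : s = (Fintype.card Fq - 1) * mIdx Fq s + 1)
    {lam : CInf Fq} (hlam : lam ^ (Fintype.card Fq - 1) = -theta Fq)
    {H : (MvPolynomial (Fin s) Fq[X])[X]} (hH : IsUniversal Fq s H) {d : ℕ} (hd1 : 1 ≤ d)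
    (hd : mIdx Fq s ≤ d) {r : ℕ} (hr : r ≤ muIdx Fq s) :
    (∏ j : Fin s, omega Fq lam j) * tConst Fq s (piTilde Fq lam)⁻¹ *
      ofKPoly Fq s (harmonicSum Fq s d 1) * (tConst Fq s (theta Fq) ^
        ((muIdx Fq s - r) * Fintype.card Fq ^ (d - mIdx Fq s)) * GammaProd Fq s d) =
      -(yInv Fq s d ^ r * ofAPoly Fq s (evalY Fq H (d - mIdx Fq s))) := by
  have h := omega_mul_PiFactor_mul_GammaProd Fq hs hlam hd1 hd
  rw [hH d hd1 hd, map_mul, ← yInv_pow_mul_theta_pow Fq d r _ hr]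
  have e : ofKPoly Fq s (MvPolynomial.map (algebraMap Fq[X] (RatFunc Fq))
      (evalY Fq H (d - mIdx Fq s))) = ofAPoly Fq s (evalY Fq H (d - mIdx Fq s)) := rfl
  rw [e]
  linear_combination (yInv Fq s d ^ r * ofAPoly Fq s (evalY Fq H (d - mIdx Fq s))) * h

theorem isUnit_omega {lam : CInf Fq} (hlam : lam ≠ 0) (j : Fin s) : IsUnit (omega Fq lam j) := by
  have h := omega_mul_omegaTail Fq lam j
  exact isUnit_of_mul_isUnit_left (h ▸ (isUnit_iff_ne_zero.2 hlam).map (tConst Fq s))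

/-- Compare sizes in U F_d Γ_d = -Y^{-μ} H(Y), with U a unit, |F_d| = 1 and Γ_d → 1. If deg H < μ,
the right side tends to 0 and so would F_d. If deg H > μ, multiplying by Y^{μ - deg H} makes the
left side tend to 0 and the right side to minus the leading coefficient, forcing H = 0. -/
theorem natDegree_of_isUniversal (hm : 1 ≤ mIdx Fq s)
    (hs : s = (Fintype.card Fq - 1) * mIdx Fq s + 1)
    {lam : CInf Fq} (hlam : lam ^ (Fintype.card Fq - 1) = -theta Fq)
    {H : (MvPolynomial (Fin s) Fq[X])[X]} (hH : IsUniversal Fq s H) :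
    H.natDegree = muIdx Fq s := by
  have hq : 1 < Fintype.card Fq := Fintype.one_lt_card
  have hlam0 : lam ≠ 0 := by
    rintro rfl
    rw [zero_pow (by omega)] at hlam
    exact neg_ne_zero.2 (theta_ne_zero Fq) hlam.symm
  have hpi : piTilde Fq lam ≠ 0 := by
    rw [piTilde_eq]
    exact mul_ne_zero (mul_ne_zero (theta_ne_zero Fq) hlam0)
      (inv_ne_zero (piTail_ne_zero Fq le_rfl))
  have hU : IsUnit ((∏ j : Fin s, omega Fq lam j) * tConst Fq s (piTilde Fq lam)⁻¹) :=
    (IsUnit.prod_univ_iff.2 fun j => isUnit_omega Fq hlam0 j).mul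
      ((isUnit_iff_ne_zero.2 (inv_ne_zero hpi)).map (tConst Fq s))
  have hid : ∀ᶠ d in atTop, (∏ j : Fin s, omega Fq lam j) * tConst Fq s (piTilde Fq lam)⁻¹ *
      ofKPoly Fq s (harmonicSum Fq s d 1) * GammaProd Fq s d =
      -(yInv Fq s d ^ muIdx Fq s * ofAPoly Fq s (evalY Fq H (d - mIdx Fq s))) := by
    filter_upwards [eventually_ge_atTop (mIdx Fq s)] with d hd
    simpa using omega_mul_harmonicSum_mul_GammaProd Fq hs hlam hH (by omega) hd le_rfl
  set U := (∏ j : Fin s, omega Fq lam j) * tConst Fq s (piTilde Fq lam)⁻¹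
  have hΓ := tendsto_GammaProd Fq hm
  have hF : ∀ d ≥ mIdx Fq s, ‖ofKPoly Fq s (harmonicSum Fq s d 1)‖ = 1 := fun d hd =>
    norm_ofKPoly_harmonicSum Fq (by omega)
  have hy := tendsto_yInv Fq s
  have hlead := tendsto_yInv_pow_mul_eval_sub Fq H le_rfl (le_refl H.natDegree)
  simp only [Nat.sub_self, Finset.Icc_eq_empty_of_lt one_pos, Finset.sum_empty, sub_zero] at hlead
  rcases lt_trichotomy H.natDegree (muIdx Fq s) with h | h | h
  · exfalso
    have h1 : Tendsto (fun d => yInv Fq s d ^ (muIdx Fq s - H.natDegree) *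
        (yInv Fq s d ^ H.natDegree * ofAPoly Fq s (evalY Fq H (d - mIdx Fq s)))) atTop (𝓝 0) := by
      have : muIdx Fq s - H.natDegree ≠ 0 := by omega
      simpa [this] using (hy.pow (muIdx Fq s - H.natDegree)).mul hlead
    have h2 : Tendsto (fun d => U * ofKPoly Fq s (harmonicSum Fq s d 1) * GammaProd Fq s d)
        atTop (𝓝 0) := by
      rw [← neg_zero]
      refine h1.neg.congr' ?_
      filter_upwards [hid] with d hd
      rw [hd, ← mul_assoc, ← pow_add, Nat.sub_add_cancel h.le]
    -- Only submultiplicativity of the Tate norm is at hand, so U is removed by multiplying with an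
    -- inverse instead of dividing norms.
    obtain ⟨V, hV⟩ := hU.exists_left_inv
    have h3 : Tendsto (fun d => ofKPoly Fq s (harmonicSum Fq s d 1) * (GammaProd Fq s d - 1))
        atTop (𝓝 0) := by
      have h4 : Tendsto (fun d => ‖GammaProd Fq s d - 1‖) atTop (𝓝 0) := by
        simpa using (hΓ.sub_const 1).norm
      refine squeeze_zero_norm' ?_ h4
      filter_upwards [eventually_ge_atTop (mIdx Fq s)] with d hd
      refine (norm_mul_le _ _).trans ?_
      rw [hF d hd, one_mul]
    have h5 : Tendsto (fun d => ‖ofKPoly Fq s (harmonicSum Fq s d 1)‖) atTop (𝓝 0) := by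
      have := ((h2.const_mul V).sub h3).norm
      rw [mul_zero, sub_zero, norm_zero] at this
      refine this.congr fun d => ?_
      congr 1
      linear_combination (ofKPoly Fq s (harmonicSum Fq s d 1) * GammaProd Fq s d) * hV
    have h6 : Tendsto (fun d => ‖ofKPoly Fq s (harmonicSum Fq s d 1)‖) atTop (𝓝 1) :=
      tendsto_const_nhds.congr' (by
        filter_upwards [eventually_ge_atTop (mIdx Fq s)] with d hd
        exact (hF d hd).symm)
    exact zero_ne_one (tendsto_nhds_unique h5 h6)
  · exact h
  · exfalso
    have h1 : Tendsto (fun d => yInv Fq s d ^ (H.natDegree - muIdx Fq s) *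
        (U * ofKPoly Fq s (harmonicSum Fq s d 1) * GammaProd Fq s d)) atTop (𝓝 0) := by
      have h0 : H.natDegree - muIdx Fq s ≠ 0 := by omega
      have h2 : Tendsto (fun d => ‖yInv Fq s d ^ (H.natDegree - muIdx Fq s)‖ *
          (‖U‖ * ‖GammaProd Fq s d‖)) atTop (𝓝 0) := by
        simpa [h0] using (hy.pow (H.natDegree - muIdx Fq s)).norm.mul (hΓ.norm.const_mul ‖U‖)
      refine squeeze_zero_norm' ?_ h2
      filter_upwards [eventually_ge_atTop (mIdx Fq s)] with d hd
      refine (norm_mul_le _ _).trans ?_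
      gcongr
      refine (norm_mul_le _ _).trans ?_
      gcongr
      refine (norm_mul_le _ _).trans ?_
      rw [hF d hd, mul_one]
    have h3 : Tendsto (fun d => -(yInv Fq s d ^ H.natDegree *
        ofAPoly Fq s (evalY Fq H (d - mIdx Fq s)))) atTop (𝓝 0) := by
      refine h1.congr' ?_
      filter_upwards [hid] with d hd
      rw [hd, mul_neg, ← mul_assoc, ← pow_add, Nat.sub_add_cancel h.le]
    have h4 := tendsto_nhds_unique h3 hlead.neg
    have h5 : ofAPoly Fq s (H.coeff H.natDegree) = ofAPoly Fq s 0 := by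
      rw [map_zero, ← neg_eq_zero, ← h4]
    have h6 := leadingCoeff_eq_zero.1 (ofAPoly_injective Fq h5)
    rw [h6] at h
    simp at h

end Limits

end TwistedHarmonic

end

theorem theorem1p4 (Fq : Type*) [Field Fq] [Fintype Fq] (s : ℕ)
    (hs : Fintype.card Fq ≤ s) (hmod : s ≡ 1 [MOD Fintype.card Fq - 1])
    (lam : CInf Fq) (hlam : lam ^ (Fintype.card Fq - 1) = -theta Fq) :
    (∃! H : (MvPolynomial (Fin s) Fq[X])[X], IsUniversal Fq s H) ∧
    (∀ r ≤ muIdx Fq s,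
      (GammaPoly Fq s r).Monic ∧ (GammaPoly Fq s r).natDegree = muIdx Fq s - r ∧
      Tendsto (fun d : ℕ =>
          tConst Fq s (theta Fq) ^
              ((muIdx Fq s - r) * Fintype.card Fq ^ (d - mIdx Fq s)) * GammaProd Fq s d
            - ofAPoly Fq s (evalY Fq (GammaPoly Fq s r) (d - mIdx Fq s)))
        atTop (𝓝 0)) ∧
    ∀ H : (MvPolynomial (Fin s) Fq[X])[X], IsUniversal Fq s H →
      H.natDegree = muIdx Fq s ∧
      ∀ r < muIdx Fq s,
        Tendsto (fun d : ℕ =>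
            -((∏ j : Fin s, omega Fq lam j) * tConst Fq s (piTilde Fq lam)⁻¹
                * ofAPoly Fq s (evalY Fq (GammaPoly Fq s r) (d - mIdx Fq s))
                * ofKPoly Fq s (harmonicSum Fq s d 1)
              + ∑ i ∈ Finset.Icc 1 (muIdx Fq s - r),
                  ofAPoly Fq s (H.coeff (i + r)) *
                    tConst Fq s (theta Fq) ^ (i * Fintype.card Fq ^ (d - mIdx Fq s))))
          atTop (𝓝 (ofAPoly Fq s (H.coeff r))) := by
  have hq : 1 < Fintype.card Fq := Fintype.one_lt_card
  have hdvd : Fintype.card Fq - 1 ∣ s - 1 := (Nat.modEq_iff_dvd' (by omega)).1 hmod.symm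
  have hs1 : s = (Fintype.card Fq - 1) * mIdx Fq s + 1 := by
    rw [mIdx, Nat.mul_div_cancel' hdvd]; omega
  have hm : 1 ≤ mIdx Fq s := (Nat.one_le_div_iff (by omega)).2 (by omega)
  obtain ⟨H₀, hH₀⟩ := exists_isUniversal Fq hs1 hm rfl
  refine ⟨⟨H₀, hH₀, fun H hH => isUniversal_unique Fq hH hH₀⟩, fun r _ =>
    ⟨monic_GammaPoly Fq s r, natDegree_GammaPoly Fq s r,
      tendsto_theta_pow_mul_GammaProd_sub Fq hm r⟩, fun H hH => ?_⟩
  have hdeg := natDegree_of_isUniversal Fq hm hs1 hlam hH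
  refine ⟨hdeg, fun r hr => ?_⟩
  have h1 := tendsto_yInv_pow_mul_eval_sub Fq H hdeg.le hr.le
  have h2 := tendsto_theta_pow_mul_GammaProd_sub Fq hm r
  set U := (∏ j : Fin s, omega Fq lam j) * tConst Fq s (piTilde Fq lam)⁻¹ with hU
  -- As |F_d| = 1, multiplying by U F_d keeps the null sequence null; this permits replacing Y^{μ-r}
  -- Γ_d by Γ_{s,r}(Y).
  have h3 : Tendsto (fun d : ℕ => (tConst Fq s (theta Fq) ^
      ((muIdx Fq s - r) * Fintype.card Fq ^ (d - mIdx Fq s)) * GammaProd Fq s d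
      - ofAPoly Fq s (evalY Fq (GammaPoly Fq s r) (d - mIdx Fq s))) *
      (U * ofKPoly Fq s (harmonicSum Fq s d 1))) atTop (𝓝 0) := by
    have h4 := h2.norm.mul_const ‖U‖
    rw [norm_zero, zero_mul] at h4
    refine squeeze_zero_norm' ?_ h4
    filter_upwards [eventually_ge_atTop (mIdx Fq s)] with d hd
    refine (norm_mul_le _ _).trans ?_
    gcongr
    refine (norm_mul_le _ _).trans ?_
    rw [norm_ofKPoly_harmonicSum Fq (by omega), mul_one]
  have h5 := h1.add h3
  rw [add_zero] at h5
  refine h5.congr' ?_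
  filter_upwards [eventually_ge_atTop (mIdx Fq s)] with d hd
  have h6 := omega_mul_harmonicSum_mul_GammaProd Fq hs1 hlam hH (by omega) hd hr.le
  rw [← hU] at h6
  linear_combination h6
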